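/- Consider a second-price auction of one indivisible good with $N \ge 2$ bidders. Values lie in a countable set $V \subseteq [0,1]$ that has a greatest element $\bar v = \max V$, and the value profile $v = (v_1,\dots,v_N)$ is drawn from a prior $\lambda \in \Delta(V^N)$. An information structure $\mathcal I = ((S_i)_{i}, \pi)$ consists of a measurable signal space $S_i$ for each bidder and a probability measure $\pi$ on $V^N \times \prod_i S_i$ whose marginal on $V^N$ is $\lambda$. It is private private if the joint law of the signals $(s_1,\dots,s_N)$ under $\pi$ is the product of the laws of the individual signals. A strategy of bidder $i$ is a measurable map $\sigma_i : S_i \to \Delta([0,\bar v])$; given the signal profile $s$, the bids $b_i \sim \sigma_i(\cdot \mid s_i)$ are independent. Let $\omega_i(b) = 1/|\arg\max_j b_j|$ if $i \in \arg\max_j b_j$ and $\omega_i(b) = 0$ otherwise, and let $\mathrm{secmax}(b)$ be the second-highest entry of $b$, counted with multiplicity. Put $$\mathrm{BS}_i(\mathcal I,\sigma) = \mathbb E_{(v,s)\sim\pi}\,\mathbb E_{b\sim\sigma(\cdot\mid s)}\big[\omega_i(b)\,(v_i - \mathrm{secmax}(b))\big], \qquad \mathrm{BS} = \sum_{i} \mathrm{BS}_i,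 \qquad \mathrm{Rev}(\mathcal I,\sigma) = \mathbb E_{(v,s)\sim\pi}\,\mathbb E_{b\sim\sigma(\cdot\mid s)}\big[\mathrm{secmax}(b)\big].$$ An equilibrium is a profile $\sigma$ with $\mathrm{BS}_i(\mathcal I,\sigma) \ge \mathrm{BS}_i(\mathcal I,\sigma_i^\dagger,\sigma_{-i})$ for every bidder $i$ and every strategy $\sigma_i^\dagger$ of bidder $i$, in which, moreover, no bidder ever bids an amount that is sure to be strictly greater than her value: for almost every signal $s_i$ and $\sigma_i(\cdot\mid s_i)$-almost every bid $b_i$, $\Pr[v_i \ge b_i \mid s_i] > 0$. **Theorem.** Suppose that the prior $\lambda$ is symmetric (invariant under permutations of the bidders) and is a product measure (independent private values). Let $\overline W = \mathbb E_{v\sim\lambda}[\max_i v_i]$ and $\mathrm{BS}_F = \mathbb E_{v\sim\lambda}[\max_i v_i - \mathrm{secmax}(v)]$, the bidder surplus under full information. Then for every pair $(B,R)$ of non-negative real numbers with $B + R = \overline W$ and $B \le \mathrm{BS}_F$ there exist a private private information structure $\mathcal I$ and an equilibrium $\sigma$ such that $\mathrm{Rev}(\mathcal I,\sigma) = R$ and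 $\mathrm{BS}(\mathcal I,\sigma) = B$. -/

import Mathlib

open MeasureTheory ProbabilityTheory

namespace SecondPriceAuction

noncomputable section

/-- The highest entry of a profile (of values or of bids). -/
def maxEntry {N : ℕ} (x : Fin N → ℝ) : ℝ := ⨆ i, x i

/-- The second-highest entry of a profile, counted with multiplicity: the largest value of
`min (x i) (x j)` over pairs of distinct indices. (It is `0` if there is only one index.) -/
def secmax {N : ℕ} (x : Fin N → ℝ) : ℝ :=
  ⨆ p : {p : Fin N × Fin N // p.1 ≠ p.2}, min (x p.1.1) (x p.1.2)

open Classical in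
/-- The set of bidders who submit the highest bid. -/
def highestBidders {N : ℕ} (b : Fin N → ℝ) : Finset (Fin N) :=
  Finset.univ.filter fun i => ∀ j, b j ≤ b i

open Classical in
/-- The probability with which bidder `i` gets the good: uniform tie-breaking among the
highest bidders. -/
def alloc {N : ℕ} (i : Fin N) (b : Fin N → ℝ) : ℝ :=
  if i ∈ highestBidders b then 1 / ((highestBidders b).card : ℝ) else 0

/-- The prior is symmetric: invariant under permutations of the bidders. -/
def IsExchangeable {N : ℕ} (prior : Measure (Fin N → ℝ)) : Prop :=
  ∀ τ : Equiv.Perm (Fin N), prior.map (fun v i => v (τ i)) = prior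

/-- The prior is a product measure (independent private values). -/
def IsProductPrior {N : ℕ} (prior : Measure (Fin N → ℝ)) : Prop :=
  ∃ μ : Fin N → Measure ℝ, (∀ i, IsProbabilityMeasure (μ i)) ∧ prior = Measure.pi μ

/-- The maximal welfare: the expected highest value. -/
def maxWelfare {N : ℕ} (prior : Measure (Fin N → ℝ)) : ℝ := ∫ v, maxEntry v ∂prior

/-- The bidder surplus under full information and bidding one's own value. -/
def fullInfoSurplus {N : ℕ} (prior : Measure (Fin N → ℝ)) : ℝ :=
  ∫ v, (maxEntry v - secmax v) ∂prior

/-- An information structure: a measurable signal space for every bidder and a joint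
probability law of value profiles and signal profiles whose value marginal is the prior. -/
structure InfoStructure {N : ℕ} (prior : Measure (Fin N → ℝ)) where
  S : Fin N → Type
  [measS : ∀ i, MeasurableSpace (S i)]
  law : Measure ((Fin N → ℝ) × (∀ i, S i))
  [isProb : IsProbabilityMeasure law]
  value_marginal : law.map Prod.fst = prior

attribute [instance] InfoStructure.measS InfoStructure.isProb

/-- A (mixed) strategy on a signal space `S`: a measurable choice of a probability measure on
the bid space `[0, vbar]` for every signal. -/
structure Strategy (S : Type) [MeasurableSpace S] (vbar : ℝ) where
  kernel : Kernel S ℝ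
  [isMarkov : IsMarkovKernel kernel]
  supported : ∀ s, ∀ᵐ b ∂(kernel s), b ∈ Set.Icc 0 vbar

attribute [instance] Strategy.isMarkov

namespace InfoStructure

variable {N : ℕ} {prior : Measure (Fin N → ℝ)}

/-- The law of bidder `i`'s signal. -/
def signalLaw (I : InfoStructure prior) (i : Fin N) : Measure (I.S i) :=
  I.law.map fun ω => ω.2 i

/-- Private private: the signal profile is distributed as the product of the laws of the
individual signals. -/
def IsPrivatePrivate (I : InfoStructure prior) : Prop :=
  I.law.map Prod.snd = Measure.pi I.signalLaw

/-- Strategy profiles, with bid space `[0, vbar]`. -/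
abbrev Profile (I : InfoStructure prior) (vbar : ℝ) : Type := ∀ i, Strategy (I.S i) vbar

/-- The law of the bid profile at a signal profile: bidders randomize independently. -/
def bidLaw (I : InfoStructure prior) {vbar : ℝ} (σ : I.Profile vbar) (s : ∀ i, I.S i) :
    Measure (Fin N → ℝ) :=
  Measure.pi fun i => (σ i).kernel (s i)

/-- Ex ante surplus of bidder `i`. -/
def bidderSurplus (I : InfoStructure prior) {vbar : ℝ} (σ : I.Profile vbar) (i : Fin N) : ℝ :=
  ∫ ω, ∫ b, alloc i b * (ω.1 i - secmax b) ∂(I.bidLaw σ ω.2) ∂I.law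

/-- Ex ante surplus of all bidders together. -/
def totalBidderSurplus (I : InfoStructure prior) {vbar : ℝ} (σ : I.Profile vbar) : ℝ :=
  ∑ i, I.bidderSurplus σ i

/-- Ex ante revenue of the seller. -/
def revenue (I : InfoStructure prior) {vbar : ℝ} (σ : I.Profile vbar) : ℝ :=
  ∫ ω, ∫ b, secmax b ∂(I.bidLaw σ ω.2) ∂I.law

/-- Bayes Nash equilibrium: no bidder gains by a unilateral change to another strategy. -/
def IsEquilibrium (I : InfoStructure prior) {vbar : ℝ} (σ : I.Profile vbar) : Prop :=
  ∀ (i : Fin N) (τ : Strategy (I.S i) vbar),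
    I.bidderSurplus (Function.update σ i τ) i ≤ I.bidderSurplus σ i

/-- Bidder `i`'s posterior belief about her own value, given her own signal. -/
def posterior (I : InfoStructure prior) (i : Fin N) : Kernel (I.S i) ℝ :=
  condDistrib (fun ω : (Fin N → ℝ) × (∀ j, I.S j) => ω.1 i) (fun ω => ω.2 i) I.law

/-- No bidder ever bids an amount that is sure to be strictly greater than her value:
given her signal, her value is at least her bid with positive probability. -/
def NoOverbidding (I : InfoStructure prior) {vbar : ℝ} (σ : I.Profile vbar) : Prop :=
  ∀ i, ∀ᵐ s ∂(I.signalLaw i), ∀ᵐ b ∂((σ i).kernel s), 0 < I.posterior i s (Set.Ici b)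

end InfoStructure

end

end SecondPriceAuction

/-! Since `B + R` is the maximal welfare, it suffices to find an efficient equilibrium with revenue
`R`, where `R` lies between `e = E[secmax v]` and `m = E[maxEntry v]`. If `R = e`, signals reveal
values and truthful bidding works (`exists_equilibrium_fullInformation`); independence of the values
makes this private private.

If `R > e`, the signals `u` are iid uniform on the unit interval and are coupled with `v` so that
the bidder with the highest signal is one with the highest value. Apart from who is highest, signals
could be uninformative: the winner would then expect `m`, a loser at most `e`, and all bids could
sit near `R`. But bids must strictly increase in the signal to make the right bidder win, so the
price fluctuates, and at `R = m` it would sometimes exceed `m`. The coupling is therefore tilted by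
a factor `1 + κ * T v * q u`, with `T = maxEntry - m` and `q = secmax - E[secmax u]`, which makes
the winner's expected value move exactly with the price. Affine bids of small slope `δ` give the
price `R + δ * q u`; choosing `κ` as `δ` over the variance of `maxEntry` gives the winner the
expected value `m + δ * q u`, which is at least the price. A loser expects at most `e + κ`, below
every bid when `δ` is small. Each bidder thus best replies at almost every signal profile, for
values averaged given that profile, and this implies equilibrium
(`InfoStructure.isEquilibrium_pureProfile`).

Because `T` and `q` have mean zero and are symmetric, the tilt preserves both marginals
(`IsTilt.integral_couplingDensity`), so the prior and the independence of the signals survive. Bids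
stay below a level `c > m` that the highest value reaches with positive probability, and no signal
rules out that the own value reaches `c` (`ae_condDistrib_couplingLaw_pos`). Such a `c` exists
unless `maxEntry` is constant; then all values coincide and `R > e` is impossible
(`fullInfoSurplus_eq_zero`). -/

namespace SecondPriceAuction

noncomputable section

/-! ### Order statistics, allocation and best replies for a fixed bid profile. -/

section Profiles

variable {N : ℕ}

lemma le_maxEntry (x : Fin N → ℝ) (i : Fin N) : x i ≤ maxEntry x :=
  le_ciSup (Set.finite_range x).bddAbove i

lemma exists_eq_maxEntry [Nonempty (Fin N)] (x : Fin N → ℝ) : ∃ i, x i = maxEntry x :=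
  exists_eq_ciSup_of_finite

lemma mem_highestBidders {b : Fin N → ℝ} {i : Fin N} :
    i ∈ highestBidders b ↔ ∀ j, b j ≤ b i := by
  simp [highestBidders]

lemma eq_maxEntry_of_mem {b : Fin N → ℝ} {i : Fin N} (h : i ∈ highestBidders b) :
    b i = maxEntry b := by
  have : Nonempty (Fin N) := ⟨i⟩
  exact le_antisymm (le_maxEntry b i) (ciSup_le (mem_highestBidders.1 h))

lemma highestBidders_nonempty [Nonempty (Fin N)] (b : Fin N → ℝ) :
    (highestBidders b).Nonempty := by
  obtain ⟨i, hi⟩ := exists_eq_maxEntry b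
  exact ⟨i, mem_highestBidders.2 fun j => hi ▸ le_maxEntry b j⟩

lemma alloc_nonneg (i : Fin N) (b : Fin N → ℝ) : 0 ≤ alloc i b := by
  unfold alloc; split_ifs <;> positivity

lemma alloc_pos {i : Fin N} {b : Fin N → ℝ} (h : ∀ j, b j ≤ b i) : 0 < alloc i b := by
  have hi := mem_highestBidders.2 h
  have : 0 < (highestBidders b).card := Finset.card_pos.2 ⟨i, hi⟩
  simp only [alloc, if_pos hi]
  positivity

lemma alloc_eq_zero {i : Fin N} {b : Fin N → ℝ} (h : ¬ ∀ j, b j ≤ b i) : alloc i b = 0 := by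
  simp [alloc, mem_highestBidders, h]

lemma alloc_eq_one {i : Fin N} {b : Fin N → ℝ} (h : ∀ j, j ≠ i → b j < b i) : alloc i b = 1 := by
  have : highestBidders b = {i} := by
    ext k
    simp only [mem_highestBidders, Finset.mem_singleton]
    constructor
    · intro hk
      by_contra hne
      exact absurd (hk i) (not_le.2 (h k hne))
    · rintro rfl j
      by_cases hj : j = k
      · simp [hj]
      · exact (h j hj).le
  simp [alloc, this]

lemma sum_alloc [Nonempty (Fin N)] (b : Fin N → ℝ) : ∑ i, alloc i b = 1 := by
  have h : ((highestBidders b).card : ℝ) ≠ 0 :=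
    Nat.cast_ne_zero.2 (Finset.card_pos.2 (highestBidders_nonempty b)).ne'
  simp [alloc, h]

lemma alloc_le_one (i : Fin N) (b : Fin N → ℝ) : alloc i b ≤ 1 := by
  have : Nonempty (Fin N) := ⟨i⟩
  rw [← sum_alloc b]
  exact Finset.single_le_sum (fun j _ => alloc_nonneg j b) (Finset.mem_univ i)

lemma abs_alloc_le_one (i : Fin N) (b : Fin N → ℝ) : |alloc i b| ≤ 1 := by
  rw [abs_of_nonneg (alloc_nonneg i b)]; exact alloc_le_one i b

lemma alloc_mul_self (i : Fin N) (b : Fin N → ℝ) : alloc i b * b i = alloc i b * maxEntry b := by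
  by_cases h : ∀ j, b j ≤ b i
  · rw [eq_maxEntry_of_mem (mem_highestBidders.2 h)]
  · simp [alloc_eq_zero h]

lemma min_le_secmax (x : Fin N → ℝ) {i j : Fin N} (h : i ≠ j) : min (x i) (x j) ≤ secmax x :=
  le_ciSup (f := fun p : {p : Fin N × Fin N // p.1 ≠ p.2} => min (x p.1.1) (x p.1.2))
    (Set.finite_range _).bddAbove ⟨(i, j), h⟩

lemma nonempty_offDiag (hN : 2 ≤ N) : Nonempty {p : Fin N × Fin N // p.1 ≠ p.2} :=
  ⟨⟨(⟨0, by omega⟩, ⟨1, by omega⟩), by simp⟩⟩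

lemma exists_secmax_eq (hN : 2 ≤ N) (x : Fin N → ℝ) :
    ∃ i j, i ≠ j ∧ secmax x = min (x i) (x j) := by
  have := nonempty_offDiag hN
  obtain ⟨p, hp⟩ := exists_eq_ciSup_of_finite
    (f := fun p : {p : Fin N × Fin N // p.1 ≠ p.2} => min (x p.1.1) (x p.1.2))
  exact ⟨p.1.1, p.1.2, p.2, hp.symm⟩

lemma secmax_le (hN : 2 ≤ N) {x : Fin N → ℝ} {c : ℝ}
    (h : ∀ i j, i ≠ j → min (x i) (x j) ≤ c) : secmax x ≤ c := by
  obtain ⟨i, j, hij, e⟩ := exists_secmax_eq hN x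
  exact e ▸ h i j hij

lemma secmax_le_maxEntry (hN : 2 ≤ N) (x : Fin N → ℝ) : secmax x ≤ maxEntry x :=
  secmax_le hN fun i _ _ => (min_le_left _ _).trans (le_maxEntry x i)

lemma secmax_mem_Icc (hN : 2 ≤ N) {x : Fin N → ℝ} {a c : ℝ} (h : ∀ i, x i ∈ Set.Icc a c) :
    secmax x ∈ Set.Icc a c := by
  obtain ⟨i, j, -, e⟩ := exists_secmax_eq hN x
  rw [e]
  exact ⟨le_min (h i).1 (h j).1, (min_le_left _ _).trans (h i).2⟩

lemma maxEntry_mem_Icc [Nonempty (Fin N)] {x : Fin N → ℝ} {a c : ℝ}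
    (h : ∀ i, x i ∈ Set.Icc a c) : maxEntry x ∈ Set.Icc a c := by
  obtain ⟨i, e⟩ := exists_eq_maxEntry x
  exact e ▸ h i

/-- The value of a bidder other than a highest one is at most the second-highest value. -/
lemma alloc_mul_le_alloc_mul_secmax {i j : Fin N} (hij : i ≠ j) (x : Fin N → ℝ) :
    alloc j x * x i ≤ alloc j x * secmax x := by
  by_cases h : ∀ k, x k ≤ x j
  · refine mul_le_mul_of_nonneg_left ?_ (alloc_nonneg j x)
    simpa [h i] using min_le_secmax x hij
  · simp [alloc_eq_zero h]

lemma secmax_comp_of_monotone (hN : 2 ≤ N) {g : ℝ → ℝ} (hg : Monotone g) (x : Fin N → ℝ) :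
    secmax (fun i => g (x i)) = g (secmax x) := by
  refine le_antisymm (secmax_le hN fun i j hij => ?_) ?_
  · rw [← hg.map_min]
    exact hg (min_le_secmax x hij)
  · obtain ⟨i, j, hij, e⟩ := exists_secmax_eq hN x
    rw [e, hg.map_min]
    exact min_le_secmax (fun i => g (x i)) hij

lemma alloc_comp_of_strictMono {g : ℝ → ℝ} (hg : StrictMono g) (i : Fin N) (x : Fin N → ℝ) :
    alloc i (fun j => g (x j)) = alloc i x := by
  have : highestBidders (fun j => g (x j)) = highestBidders x := by
    ext k; simp [mem_highestBidders, hg.le_iff_le]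
  simp [alloc, this]

lemma alloc_comp_perm (τ : Equiv.Perm (Fin N)) (i : Fin N) (x : Fin N → ℝ) :
    alloc i (fun j => x (τ j)) = alloc (τ i) x := by
  have : highestBidders x = (highestBidders fun j => x (τ j)).map τ.toEmbedding := by
    ext k
    simp only [mem_highestBidders, Finset.mem_map_equiv, Equiv.apply_symm_apply]
    exact ⟨fun h j => h _, fun h j => by simpa using h (τ.symm j)⟩
  have h2 : (∀ j, x (τ j) ≤ x (τ i)) ↔ ∀ j, x j ≤ x (τ i) :=
    ⟨fun h j => by simpa using h (τ.symm j), fun h j => h _⟩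
  simp only [alloc, mem_highestBidders, h2]
  rw [this, Finset.card_map]

lemma maxEntry_comp_perm (τ : Equiv.Perm (Fin N)) (x : Fin N → ℝ) :
    maxEntry (fun j => x (τ j)) = maxEntry x :=
  τ.iSup_comp (g := x)

lemma secmax_comp_perm (hN : 2 ≤ N) (τ : Equiv.Perm (Fin N)) (x : Fin N → ℝ) :
    secmax (fun j => x (τ j)) = secmax x := by
  refine le_antisymm
    (secmax_le hN fun i j hij => min_le_secmax x (τ.injective.ne hij))
    (secmax_le hN fun i j hij => ?_)
  simpa using min_le_secmax (fun j => x (τ j)) (τ.symm.injective.ne hij)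

@[fun_prop]
lemma measurable_maxEntry : Measurable (maxEntry (N := N)) :=
  Measurable.iSup fun i => measurable_pi_apply i

@[fun_prop]
lemma measurable_secmax : Measurable (secmax (N := N)) :=
  Measurable.iSup fun _ => (measurable_pi_apply _).min (measurable_pi_apply _)

lemma measurableSet_highest (i : Fin N) : MeasurableSet {b : Fin N → ℝ | ∀ j, b j ≤ b i} := by
  simp only [Set.ofPred_forall]
  exact MeasurableSet.iInter fun j =>
    measurableSet_le (measurable_pi_apply j) (measurable_pi_apply i)

@[fun_prop]
lemma measurable_alloc (i : Fin N) : Measurable (alloc i) := by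
  classical
  have h : alloc i = fun b : Fin N → ℝ => if (∀ j, b j ≤ b i) then
      1 / ∑ k, (if (∀ j, b j ≤ b k) then (1 : ℝ) else 0) else 0 := by
    ext b
    simp [alloc, highestBidders]
  rw [h]
  refine Measurable.ite (measurableSet_highest i) (measurable_const.div ?_) measurable_const
  exact Finset.measurable_sum _ fun k _ =>
    Measurable.ite (measurableSet_highest k) measurable_const measurable_const

/-- The highest bid among the opponents of bidder `i`. -/
def othersMax (i : Fin N) (b : Fin N → ℝ) : ℝ := ⨆ j : {j // j ≠ i}, b j

lemma le_othersMax {i j : Fin N} (h : j ≠ i) (b : Fin N → ℝ) : b j ≤ othersMax i b :=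
  le_ciSup (f := fun j : {j // j ≠ i} => b j) (Set.finite_range _).bddAbove ⟨j, h⟩

lemma exists_othersMax_eq (hN : 2 ≤ N) (i : Fin N) (b : Fin N → ℝ) :
    ∃ j, j ≠ i ∧ b j = othersMax i b := by
  have : Nontrivial (Fin N) := Fin.nontrivial_iff_two_le.2 hN
  have : Nonempty {j // j ≠ i} := let ⟨j, hj⟩ := exists_ne i; ⟨⟨j, hj⟩⟩
  obtain ⟨j, hj⟩ := exists_eq_ciSup_of_finite (f := fun j : {j // j ≠ i} => b j)
  exact ⟨j.1, j.2, hj⟩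

lemma othersMax_update (i : Fin N) (b : Fin N → ℝ) (t : ℝ) :
    othersMax i (Function.update b i t) = othersMax i b := by
  unfold othersMax
  congr 1; ext j
  simp [j.2]

lemma secmax_eq_othersMax (hN : 2 ≤ N) {i : Fin N} {b : Fin N → ℝ} (h : ∀ j, b j ≤ b i) :
    secmax b = othersMax i b := by
  refine le_antisymm (secmax_le hN fun k l hkl => ?_) ?_
  · by_cases hk : k = i
    · exact (min_le_right _ _).trans (le_othersMax (fun e => hkl (hk.trans e.symm)) b)
    · exact (min_le_left _ _).trans (le_othersMax hk b)
  · obtain ⟨j, hj, e⟩ := exists_othersMax_eq hN i b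
    rw [← e]
    simpa [h j] using min_le_secmax b hj

/-- The right side is the best-reply benchmark: a winner pays `othersMax`, whatever the own bid, so
the best outcome is to win at that price or to lose. -/
lemma alloc_mul_sub_secmax_le (hN : 2 ≤ N) (i : Fin N) (b : Fin N → ℝ) (w : ℝ) :
    alloc i b * (w - secmax b) ≤ max (w - othersMax i b) 0 := by
  by_cases h : ∀ j, b j ≤ b i
  · rw [secmax_eq_othersMax hN h]
    have h0 := alloc_nonneg i b
    have h1 := alloc_le_one i b
    rcases le_total (w - othersMax i b) 0 with hw | hw
    · exact le_max_of_le_right (mul_nonpos_of_nonneg_of_nonpos h0 hw)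
    · exact le_max_of_le_left (mul_le_of_le_one_left hw h1)
  · simp [alloc_eq_zero h]

/-- Bidding one's value is a best reply to every profile of opposing bids. -/
lemma le_alloc_mul_of_bid_eq (hN : 2 ≤ N) (i : Fin N) (b : Fin N → ℝ) :
    max (b i - othersMax i b) 0 ≤ alloc i b * (b i - secmax b) := by
  by_cases h : ∀ j, b j ≤ b i
  · rw [secmax_eq_othersMax hN h]
    obtain ⟨j, hj, e⟩ := exists_othersMax_eq hN i b
    rcases (h j).lt_or_eq with hlt | heq
    · rw [alloc_eq_one, one_mul, max_eq_left]
      · linarith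
      · exact fun k hk => (le_othersMax hk b).trans_lt (e ▸ hlt)
    -- In a tie for the top the price equals the own bid, so both sides are zero.
    · simp [← e, heq]
  · rw [alloc_eq_zero h, zero_mul]
    push Not at h
    obtain ⟨j, hj⟩ := h
    have := le_othersMax (i := i) (j := j) (by rintro rfl; exact lt_irrefl _ hj) b
    exact max_le (by linarith) le_rfl

/-- A bid is a best reply if it is the only highest bid and the price is at most the value, or
some higher bid is at least the value. -/
lemma le_alloc_mul_of_winner_or_loser (hN : 2 ≤ N) (i : Fin N) (b : Fin N → ℝ) (w : ℝ)
    (h : ((∀ j, j ≠ i → b j < b i) ∧ secmax b ≤ w) ∨ ∃ j, b i < b j ∧ w ≤ b j) :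
    max (w - othersMax i b) 0 ≤ alloc i b * (w - secmax b) := by
  rcases h with ⟨h, hw⟩ | ⟨j, hj, hw⟩
  · have h' : ∀ j, b j ≤ b i := fun j => by
      by_cases hj : j = i
      · simp [hj]
      · exact (h j hj).le
    rw [alloc_eq_one h, one_mul, ← secmax_eq_othersMax hN h']
    exact max_le le_rfl (by linarith)
  · rw [alloc_eq_zero fun h => absurd (h j) (not_le.2 hj), zero_mul]
    have := le_othersMax (i := i) (j := j) (by rintro rfl; exact lt_irrefl _ hj) b
    exact max_le (by linarith) le_rfl

end Profiles

/-! ### Exchangeable laws. -/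

section Symmetry

variable {N : ℕ} {Q : Measure (Fin N → ℝ)}

lemma IsExchangeable.integral_comp (hQ : IsExchangeable Q) (τ : Equiv.Perm (Fin N))
    {f : (Fin N → ℝ) → ℝ} (hf : Measurable f) : ∫ v, f (fun i => v (τ i)) ∂Q = ∫ v, f v ∂Q := by
  conv_rhs => rw [← hQ τ]
  rw [integral_map (measurable_pi_lambda _ fun i => measurable_pi_apply _).aemeasurable
    hf.aestronglyMeasurable]

/-- Under an exchangeable law, a symmetric integrand weighs equally on the events that the
different bidders are allocated the good. -/
lemma IsExchangeable.integral_alloc_mul [IsFiniteMeasure Q] (hQ : IsExchangeable Q)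
    {f : (Fin N → ℝ) → ℝ} (hf : Measurable f) (hint : Integrable f Q)
    (hsymm : ∀ (τ : Equiv.Perm (Fin N)) v, f (fun i => v (τ i)) = f v) (i : Fin N) :
    N * ∫ v, alloc i v * f v ∂Q = ∫ v, f v ∂Q := by
  have : Nonempty (Fin N) := ⟨i⟩
  have hi : ∀ j, Integrable (fun v => alloc j v * f v) Q := fun j =>
    hint.bdd_mul (c := 1) (measurable_alloc j).aestronglyMeasurable
      (.of_forall fun v => by simpa using abs_alloc_le_one j v)
  have h1 : ∀ j, ∫ v, alloc j v * f v ∂Q = ∫ v, alloc i v * f v ∂Q := fun j => by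
    rw [← hQ.integral_comp (Equiv.swap i j) (f := fun v => alloc i v * f v) (by fun_prop)]
    simp [alloc_comp_perm, hsymm]
  calc N * ∫ v, alloc i v * f v ∂Q = ∑ j, ∫ v, alloc j v * f v ∂Q := by simp [h1]
    _ = ∫ v, ∑ j, alloc j v * f v ∂Q := (integral_finsetSum _ fun j _ => hi j).symm
    _ = ∫ v, f v ∂Q := by simp [← Finset.sum_mul, sum_alloc]

lemma isExchangeable_pi (ν : Measure ℝ) [SigmaFinite ν] :
    IsExchangeable (Measure.pi fun _ : Fin N => ν) := by
  intro τ
  refine (Measure.pi_eq fun s hs => ?_).symm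
  rw [Measure.map_apply (by fun_prop) (.univ_pi hs)]
  have : (fun (v : Fin N → ℝ) i => v (τ i)) ⁻¹' Set.univ.pi s
      = Set.univ.pi fun i => s (τ.symm i) := by
    ext v
    simp only [Set.mem_preimage, Set.mem_univ_pi]
    exact ⟨fun h i => by simpa using h (τ.symm i), fun h i => by simpa using h (τ i)⟩
  rw [this, Measure.pi_pi]
  exact τ.symm.prod_comp fun i => ν (s i)

end Symmetry

/-! ### Pure strategy profiles and a sufficient condition for equilibrium. -/

section PureStrategies

/-- The strategy that bids `β s` at the signal `s`. -/
def Strategy.pure {S : Type} [MeasurableSpace S] {vbar : ℝ} (β : S → ℝ) (hβ : Measurable β)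
    (h : ∀ s, β s ∈ Set.Icc 0 vbar) : Strategy S vbar where
  kernel := Kernel.deterministic β hβ
  supported s := by
    rw [Kernel.deterministic_apply]
    exact (ae_dirac_iff (p := fun b => b ∈ Set.Icc 0 vbar) measurableSet_Icc).2 (h s)

/-- Deviations may be mixed while the opponents bid purely; this reduces an integral over bid
profiles to one over the deviator's bid. -/
lemma pi_update_dirac {N : ℕ} (b : Fin N → ℝ) (i : Fin N) (m : Measure ℝ)
    [IsProbabilityMeasure m] (κ : Fin N → Measure ℝ) [∀ j, IsProbabilityMeasure (κ j)]
    (hi : κ i = m) (hκ : ∀ j, j ≠ i → κ j = Measure.dirac (b j)) :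
    Measure.pi κ = m.map fun t => Function.update b i t := by
  refine Measure.pi_eq fun s hs => ?_
  rw [Measure.map_apply (by fun_prop) (.univ_pi hs), ← Finset.mul_prod_erase _ _ (Finset.mem_univ i),
    hi]
  have h1 : ∏ j ∈ Finset.univ.erase i, κ j (s j)
      = ∏ j ∈ Finset.univ.erase i, (s j).indicator 1 (b j) :=
    Finset.prod_congr rfl fun j hj => by
      rw [hκ j (Finset.ne_of_mem_erase hj), Measure.dirac_apply' _ (hs j)]
  rw [h1]
  by_cases hb : ∀ j, j ≠ i → b j ∈ s j
  · rw [Finset.prod_eq_one, mul_one]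
    · congr 1
      ext t
      simp only [Set.mem_preimage, Set.mem_univ_pi]
      refine ⟨fun h => by simpa using h i, fun h j => ?_⟩
      by_cases hj : j = i
      · subst hj; simpa using h
      · simpa [hj] using hb j hj
    · intro j hj
      simp [hb j (Finset.ne_of_mem_erase hj)]
  · push Not at hb
    obtain ⟨j, hj, hbj⟩ := hb
    rw [Finset.prod_eq_zero (i := j) (by simp [hj]) (by simp [hbj]), mul_zero]
    have : (fun t => Function.update b i t) ⁻¹' Set.univ.pi s = ∅ := by
      ext t
      simp only [Set.mem_preimage, Set.mem_univ_pi, Set.mem_empty_iff_false, iff_false]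
      intro h
      exact hbj (by simpa [hj] using h j)
    rw [this, measure_empty]

variable {N : ℕ} {prior : Measure (Fin N → ℝ)} (I : InfoStructure prior) {vbar : ℝ}

/-- The profile of pure strategies `β`. -/
def InfoStructure.pureProfile (β : ∀ i, I.S i → ℝ) (hβ : ∀ i, Measurable (β i))
    (h : ∀ i s, β i s ∈ Set.Icc 0 vbar) : I.Profile vbar :=
  fun i => Strategy.pure (β i) (hβ i) (h i)

variable (β : ∀ i, I.S i → ℝ) (hβ : ∀ i, Measurable (β i)) (h : ∀ i s, β i s ∈ Set.Icc 0 vbar)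

lemma InfoStructure.bidLaw_update (i : Fin N) (τ : Strategy (I.S i) vbar) (s : ∀ i, I.S i) :
    I.bidLaw (Function.update (I.pureProfile β hβ h) i τ) s
      = (τ.kernel (s i)).map fun t => Function.update (fun j => β j (s j)) i t := by
  refine pi_update_dirac _ i _ _ (by simp) fun j hj => ?_
  rw [Function.update_of_ne hj]
  exact Kernel.deterministic_apply (hβ j) _

lemma InfoStructure.bidLaw_pureProfile (s : ∀ i, I.S i) :
    I.bidLaw (I.pureProfile β hβ h) s = Measure.dirac fun j => β j (s j) := by
  refine Measure.pi_eq fun t ht => ?_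
  rw [Measure.dirac_apply' _ (.univ_pi ht)]
  have : ∀ i, ((I.pureProfile β hβ h i).kernel (s i)) (t i) = (t i).indicator 1 (β i (s i)) :=
    fun i => by
      rw [← Measure.dirac_apply' _ (ht i)]
      exact congrArg (· (t i)) (Kernel.deterministic_apply (hβ i) (s i))
  simp only [this]
  by_cases hb : ∀ j, β j (s j) ∈ t j
  · rw [Set.indicator_of_mem (by simpa using hb), Finset.prod_eq_one]
    · rfl
    · intro j _; simp [hb j]
  · rw [Set.indicator_of_notMem (by simpa using hb)]
    push Not at hb
    obtain ⟨j, hj⟩ := hb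
    exact (Finset.prod_eq_zero (Finset.mem_univ j) (by simp [hj])).symm

lemma InfoStructure.revenue_pureProfile :
    I.revenue (I.pureProfile β hβ h) = ∫ ω, secmax (fun j => β j (ω.2 j)) ∂I.law := by
  simp only [InfoStructure.revenue, I.bidLaw_pureProfile β hβ h]
  congr 1; ext ω
  exact integral_dirac' _ _ measurable_secmax.stronglyMeasurable

lemma InfoStructure.bidderSurplus_pureProfile (i : Fin N) :
    I.bidderSurplus (I.pureProfile β hβ h) i
      = ∫ ω, alloc i (fun j => β j (ω.2 j)) * (ω.1 i - secmax fun j => β j (ω.2 j)) ∂I.law := by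
  simp only [InfoStructure.bidderSurplus, I.bidLaw_pureProfile β hβ h]
  congr 1; ext ω
  exact integral_dirac' _ _ (Measurable.stronglyMeasurable (by fun_prop))

lemma InfoStructure.noOverbidding_pureProfile
    (hpos : ∀ i, ∀ᵐ s ∂I.signalLaw i, 0 < I.posterior i s (Set.Ici (β i s))) :
    I.NoOverbidding (I.pureProfile β hβ h) := by
  intro i
  filter_upwards [hpos i] with s hs
  have : (I.pureProfile β hβ h i).kernel s = Measure.dirac (β i s) :=
    Kernel.deterministic_apply (hβ i) s
  rw [this, ae_dirac_eq]
  exact hs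

/-- A pure profile is an equilibrium if it is an ex post equilibrium for the values `w`
that the bidders expect given the whole signal profile. -/
theorem InfoStructure.isEquilibrium_pureProfile (hN : 2 ≤ N)
    (hint : ∀ i, Integrable (fun ω => ω.1 i) I.law)
    (w : ∀ _ : Fin N, (∀ i, I.S i) → ℝ)
    (hwint : ∀ i, Integrable (fun ω => w i ω.2) I.law)
    (hw : ∀ i (X : (∀ i, I.S i) → ℝ), Measurable X → (∀ s, |X s| ≤ 1) →
      ∫ ω, X ω.2 * ω.1 i ∂I.law = ∫ ω, X ω.2 * w i ω.2 ∂I.law)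
    (hbest : ∀ i, ∀ᵐ ω ∂I.law,
      max (w i ω.2 - othersMax i fun j => β j (ω.2 j)) 0
        ≤ alloc i (fun j => β j (ω.2 j)) * (w i ω.2 - secmax fun j => β j (ω.2 j))) :
    I.IsEquilibrium (I.pureProfile β hβ h) := by
  intro i τ
  set up : (∀ i, I.S i) → ℝ → Fin N → ℝ := fun s t => Function.update (fun j => β j (s j)) i t
    with hup
  have hupm : Measurable fun p : (∀ i, I.S i) × ℝ => up p.1 p.2 := by
    refine measurable_pi_lambda _ fun j => ?_
    by_cases hj : j = i
    · subst hj; simpa [hup] using measurable_snd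
    · have : Measurable fun p : (∀ i, I.S i) × ℝ => β j (p.1 j) :=
        (hβ j).comp ((measurable_pi_apply j).comp measurable_fst)
      simpa [hup, hj] using this
  have hsec : ∀ s, ∀ᵐ t ∂τ.kernel (s i), |secmax (up s t)| ≤ vbar := fun s => by
    filter_upwards [τ.supported (s i)] with t ht
    have := secmax_mem_Icc hN (x := up s t) (a := 0) (c := vbar) fun j => by
      by_cases hj : j = i
      · subst hj; simpa [hup] using ht
      · simpa [hup, hj] using h j (s j)
    rw [abs_of_nonneg this.1]; exact this.2
  have hai : ∀ s, Integrable (fun t => alloc i (up s t)) (τ.kernel (s i)) := fun s =>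
    .of_bound (Measurable.aestronglyMeasurable
      ((measurable_alloc i).comp (hupm.comp measurable_prodMk_left))) 1
      (.of_forall fun t => by simpa using abs_alloc_le_one i _)
  have hpi : ∀ s, Integrable (fun t => alloc i (up s t) * secmax (up s t)) (τ.kernel (s i)) :=
    fun s => (Integrable.of_bound (Measurable.aestronglyMeasurable
      (measurable_secmax.comp (hupm.comp measurable_prodMk_left))) vbar (hsec s)).bdd_mul (c := 1)
      (hai s).aestronglyMeasurable (.of_forall fun t => by simpa using abs_alloc_le_one i _)
  -- `X` is the deviator's probability of winning and `Y` her expected payment at a signal profile.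
  -- Her payoff `X * v i - Y` is linear in the value with a coefficient depending on signals only,
  -- so `hw` lets `w i` replace the value.
  set X : (∀ i, I.S i) → ℝ := fun s => ∫ t, alloc i (up s t) ∂τ.kernel (s i) with hX
  set Y : (∀ i, I.S i) → ℝ := fun s => ∫ t, alloc i (up s t) * secmax (up s t) ∂τ.kernel (s i)
    with hY
  have hmeas : ∀ f : (Fin N → ℝ) → ℝ, Measurable f →
      Measurable fun s : ∀ i, I.S i => ∫ t, f (up s t) ∂τ.kernel (s i) := fun f hf => by
    have := StronglyMeasurable.integral_kernel_prod_right'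
      (κ := τ.kernel.comap (fun s : ∀ i, I.S i => s i) (measurable_pi_apply i))
      (f := fun p : (∀ i, I.S i) × ℝ => f (up p.1 p.2)) (hf.comp hupm).stronglyMeasurable
    simpa using this.measurable
  have hXm : Measurable X := hmeas _ (measurable_alloc i)
  have hYm : Measurable Y := hmeas (fun b => alloc i b * secmax b) (by fun_prop)
  have hX1 : ∀ s, |X s| ≤ 1 := fun s => by
    have := norm_integral_le_of_norm_le_const (μ := τ.kernel (s i)) (C := 1)
      (f := fun t => alloc i (up s t)) (.of_forall fun t => by simpa using abs_alloc_le_one i _)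
    simpa using this
  have hY1 : ∀ s, |Y s| ≤ vbar := fun s => by
    have := norm_integral_le_of_norm_le_const (μ := τ.kernel (s i)) (C := vbar)
      (f := fun t => alloc i (up s t) * secmax (up s t)) (by
        filter_upwards [hsec s] with t ht
        rw [norm_mul, Real.norm_eq_abs, Real.norm_eq_abs]
        exact (mul_le_mul (abs_alloc_le_one i _) ht (abs_nonneg _) zero_le_one).trans
          (one_mul _).le)
    simpa using this
  have hinner : ∀ c s, ∫ t, alloc i (up s t) * (c - secmax (up s t)) ∂τ.kernel (s i)
      = X s * c - Y s := fun c s => by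
    simp only [mul_sub]
    rw [integral_sub ((hai s).mul_const c) (hpi s), integral_mul_const]
  have hYint : Integrable (fun ω => Y ω.2) I.law :=
    .of_bound (hYm.comp measurable_snd).aestronglyMeasurable vbar (.of_forall fun ω => hY1 _)
  have hXint : ∀ f : (Fin N → ℝ) × (∀ i, I.S i) → ℝ, Integrable f I.law →
      Integrable (fun ω => X ω.2 * f ω) I.law := fun f hf =>
    hf.bdd_mul (c := 1) (hXm.comp measurable_snd).aestronglyMeasurable (.of_forall fun ω => hX1 _)
  have hdev : I.bidderSurplus (Function.update (I.pureProfile β hβ h) i τ) i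
      = ∫ ω, (X ω.2 * w i ω.2 - Y ω.2) ∂I.law := by
    rw [integral_sub (hXint _ (hwint i)) hYint, ← hw i X hXm hX1,
      ← integral_sub (hXint _ (hint i)) hYint]
    unfold InfoStructure.bidderSurplus
    congr 1; ext ω
    rw [I.bidLaw_update β hβ h, ← hinner, integral_map (by fun_prop)
      (Measurable.aestronglyMeasurable (by fun_prop))]
  set bs : (∀ i, I.S i) → Fin N → ℝ := fun s j => β j (s j) with hbs
  have hbsm : Measurable bs := measurable_pi_lambda _ fun j => (hβ j).comp (measurable_pi_apply j)
  have hZm : Measurable fun s => alloc i (bs s) := (measurable_alloc i).comp hbsm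
  have hsm : Measurable fun s => secmax (bs s) := measurable_secmax.comp hbsm
  have hsint : Integrable (fun ω => secmax (bs ω.2)) I.law :=
    .of_bound (hsm.comp measurable_snd).aestronglyMeasurable vbar (.of_forall fun ω => by
      have := secmax_mem_Icc hN (x := bs ω.2) (a := 0) (c := vbar) fun j => h j _
      rw [Real.norm_eq_abs, abs_of_nonneg this.1]; exact this.2)
  have hZint : ∀ f : (Fin N → ℝ) × (∀ i, I.S i) → ℝ, Integrable f I.law →
      Integrable (fun ω => alloc i (bs ω.2) * f ω) I.law := fun f hf =>
    hf.bdd_mul (c := 1) (hZm.comp measurable_snd).aestronglyMeasurable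
      (.of_forall fun ω => by simpa using abs_alloc_le_one i _)
  have heq : I.bidderSurplus (I.pureProfile β hβ h) i
      = ∫ ω, alloc i (bs ω.2) * (w i ω.2 - secmax (bs ω.2)) ∂I.law := by
    rw [I.bidderSurplus_pureProfile β hβ h]
    simp only [mul_sub]
    rw [integral_sub (hZint _ (hint i)) (hZint _ hsint),
      integral_sub (hZint _ (hwint i)) (hZint _ hsint),
      hw i _ hZm fun s => abs_alloc_le_one i _]
  rw [hdev, heq]
  refine integral_mono_ae ((hXint _ (hwint i)).sub hYint)
    (hZint _ ((hwint i).sub hsint)) ?_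
  filter_upwards [hbest i] with ω hω
  refine le_trans ?_ hω
  change X ω.2 * w i ω.2 - Y ω.2 ≤ _
  rw [← hinner]
  -- The bound does not depend on the deviating bid, because `othersMax` ignores it; averaging over
  -- that bid therefore changes nothing.
  calc _ ≤ ∫ _, max (w i ω.2 - othersMax i (bs ω.2)) 0 ∂τ.kernel (ω.2 i) := by
        refine integral_mono ?_ (integrable_const _) fun t => ?_
        · simp only [mul_sub]
          exact ((hai ω.2).mul_const _).sub (hpi ω.2)
        · have := alloc_mul_sub_secmax_le hN i (up ω.2 t) (w i ω.2)
          rwa [hup, othersMax_update] at this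
    _ = _ := by simp [hbs]

end PureStrategies

/-! ### Welfare accounting, real-valued signals and the full-information equilibrium. -/

section FullInformation

variable {N : ℕ} {prior : Measure (Fin N → ℝ)} {vbar : ℝ}

lemma InfoStructure.ae_law_of_ae_prior (I : InfoStructure prior) {p : (Fin N → ℝ) → Prop}
    (hp : ∀ᵐ v ∂prior, p v) : ∀ᵐ ω ∂I.law, p ω.1 := by
  have h := I.value_marginal
  exact ae_of_ae_map measurable_fst.aemeasurable (by rwa [h])

lemma InfoStructure.integrable_value (I : InfoStructure prior)
    (hprior : ∀ᵐ v ∂prior, ∀ i, v i ∈ Set.Icc 0 vbar) (i : Fin N) :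
    Integrable (fun ω => ω.1 i) I.law :=
  .of_bound (Measurable.aestronglyMeasurable (by fun_prop)) vbar (by
    filter_upwards [I.ae_law_of_ae_prior hprior] with ω hω
    rw [Real.norm_eq_abs, abs_of_nonneg (hω i).1]
    exact (hω i).2)

/-- If the good always goes to a bidder with the highest value, then the bidders and the seller
share the maximal welfare. -/
lemma InfoStructure.totalBidderSurplus_add_revenue (I : InfoStructure prior) (hN : 2 ≤ N)
    (hprior : ∀ᵐ v ∂prior, ∀ i, v i ∈ Set.Icc 0 vbar)
    (β : ∀ i, I.S i → ℝ) (hβ : ∀ i, Measurable (β i)) (h : ∀ i s, β i s ∈ Set.Icc 0 vbar)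
    (heff : ∀ᵐ ω ∂I.law, ∑ i, alloc i (fun j => β j (ω.2 j)) * ω.1 i = maxEntry ω.1) :
    I.totalBidderSurplus (I.pureProfile β hβ h) + I.revenue (I.pureProfile β hβ h)
      = maxWelfare prior := by
  have : Nonempty (Fin N) := ⟨⟨0, by omega⟩⟩
  have hbm : Measurable fun s : ∀ i, I.S i => fun j => β j (s j) :=
    measurable_pi_lambda _ fun j => (hβ j).comp (measurable_pi_apply j)
  have hZ : ∀ (i : Fin N) (f : (Fin N → ℝ) × (∀ i, I.S i) → ℝ), Integrable f I.law →
      Integrable (fun ω => alloc i (fun j => β j (ω.2 j)) * f ω) I.law := fun i f hf =>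
    hf.bdd_mul (c := 1)
      ((measurable_alloc i).comp (hbm.comp measurable_snd)).aestronglyMeasurable
      (.of_forall fun ω => by simpa using abs_alloc_le_one i _)
  have hs : Integrable (fun ω => secmax fun j => β j (ω.2 j)) I.law :=
    .of_bound (measurable_secmax.comp (hbm.comp measurable_snd)).aestronglyMeasurable vbar
      (.of_forall fun ω => by
        have := secmax_mem_Icc hN fun j => h j (ω.2 j)
        rw [Real.norm_eq_abs, abs_of_nonneg this.1]; exact this.2)
  have hd : ∀ i : Fin N, Integrable (fun ω => alloc i (fun j => β j (ω.2 j)) *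
      (ω.1 i - secmax fun j => β j (ω.2 j))) I.law := fun i =>
    hZ i _ ((I.integrable_value hprior i).sub hs)
  unfold InfoStructure.totalBidderSurplus
  simp only [I.bidderSurplus_pureProfile β hβ h, I.revenue_pureProfile β hβ h]
  rw [← integral_finsetSum _ fun i _ => hd i, ← integral_add (integrable_finsetSum _ fun i _ => hd i) hs]
  have hW : maxWelfare prior = ∫ ω, maxEntry ω.1 ∂I.law := by
    have h := integral_map (μ := I.law) measurable_fst.aemeasurable
      (measurable_maxEntry (N := N)).aestronglyMeasurable
    rwa [I.value_marginal] at h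
  rw [hW]
  refine integral_congr_ae ?_
  filter_upwards [heff] with ω hω
  rw [← hω]
  simp only [mul_sub, Finset.sum_sub_distrib, ← Finset.sum_mul, sum_alloc]
  ring

/-- A law of values and real signals, independent across bidders, yields an equilibrium in which
the good always goes to a bidder with the highest value, if the bidders' functions `β` of
the signals form an ex post equilibrium for the values `w` expected given all signals. -/
theorem exists_equilibrium_of_real_signals (hN : 2 ≤ N)
    (hprior : ∀ᵐ v ∂prior, ∀ i, v i ∈ Set.Icc 0 vbar)
    (Λ : Measure ((Fin N → ℝ) × (Fin N → ℝ))) [IsProbabilityMeasure Λ]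
    (hfst : Λ.map Prod.fst = prior)
    (ν : Fin N → Measure ℝ) [∀ i, IsProbabilityMeasure (ν i)] (hsnd : Λ.map Prod.snd = Measure.pi ν)
    (β : ℝ → ℝ) (hβ : Measurable β) (hβI : ∀ s, β s ∈ Set.Icc 0 vbar)
    (w : Fin N → (Fin N → ℝ) → ℝ) (hwint : ∀ i, Integrable (fun ω => w i ω.2) Λ)
    (hw : ∀ i (X : (Fin N → ℝ) → ℝ), Measurable X → (∀ s, |X s| ≤ 1) →
      ∫ ω, X ω.2 * ω.1 i ∂Λ = ∫ ω, X ω.2 * w i ω.2 ∂Λ)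
    (hbest : ∀ i, ∀ᵐ ω ∂Λ, max (w i ω.2 - othersMax i fun j => β (ω.2 j)) 0
        ≤ alloc i (fun j => β (ω.2 j)) * (w i ω.2 - secmax fun j => β (ω.2 j)))
    (heff : ∀ᵐ ω ∂Λ, ∑ i, alloc i (fun j => β (ω.2 j)) * ω.1 i = maxEntry ω.1)
    (hpos : ∀ i, ∀ᵐ s ∂ν i,
      0 < condDistrib (fun ω => ω.1 i) (fun ω => ω.2 i) Λ s (Set.Ici (β s))) :
    ∃ I : InfoStructure prior, I.IsPrivatePrivate ∧
      ∃ σ : I.Profile vbar, I.IsEquilibrium σ ∧ I.NoOverbidding σ ∧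
        I.revenue σ = ∫ ω, secmax (fun j => β (ω.2 j)) ∂Λ ∧
        I.totalBidderSurplus σ + I.revenue σ = maxWelfare prior := by
  let I : InfoStructure prior := { S := fun _ => ℝ, law := Λ, value_marginal := hfst }
  have hsig : I.signalLaw = ν := by
    ext1 i
    have h1 : Λ.map (fun ω => ω.2 i) = (Λ.map Prod.snd).map (Function.eval i) := by
      rw [Measure.map_map (measurable_pi_apply i) measurable_snd]; rfl
    rw [hsnd, (measurePreserving_eval ν i).map_eq] at h1
    exact h1
  refine ⟨I, ?_, I.pureProfile (fun _ => β) (fun _ => hβ) (fun _ => hβI), ?_, ?_, ?_, ?_⟩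
  · unfold InfoStructure.IsPrivatePrivate
    rw [hsig]
    exact hsnd
  · exact I.isEquilibrium_pureProfile _ _ _ hN (I.integrable_value hprior) w hwint hw hbest
  · refine I.noOverbidding_pureProfile _ _ _ fun i => ?_
    rw [hsig]
    exact hpos i
  · exact I.revenue_pureProfile _ _ _
  · exact I.totalBidderSurplus_add_revenue hN hprior _ _ _ heff

/-- Full information and truthful bidding attain the full-information surplus. -/
theorem exists_equilibrium_fullInformation [IsProbabilityMeasure prior] (hN : 2 ≤ N)
    (hv : 0 ≤ vbar) (hprior : ∀ᵐ v ∂prior, ∀ i, v i ∈ Set.Icc 0 vbar)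
    (hprod : IsProductPrior prior) :
    ∃ I : InfoStructure prior, I.IsPrivatePrivate ∧
      ∃ σ : I.Profile vbar, I.IsEquilibrium σ ∧ I.NoOverbidding σ ∧
        I.revenue σ = ∫ v, secmax v ∂prior ∧
        I.totalBidderSurplus σ + I.revenue σ = maxWelfare prior := by
  have : Nonempty (Fin N) := ⟨⟨0, by omega⟩⟩
  -- Truthful bidding, truncated because a strategy must respect the bid space at every real signal,
  -- including those of probability zero.
  set g : ℝ → ℝ := fun s => max 0 (min s vbar) with hg
  have hgm : Measurable g := by fun_prop
  have hgI : ∀ s, g s ∈ Set.Icc 0 vbar := fun s =>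
    ⟨le_max_left _ _, max_le hv (min_le_right _ _)⟩
  have hgid : ∀ s ∈ Set.Icc 0 vbar, g s = s := fun s hs => by simp [hg, hs.1, hs.2]
  obtain ⟨μ, hμ, hpi⟩ := hprod
  have hd : Measurable fun v : Fin N → ℝ => (v, v) := by fun_prop
  set Λ : Measure ((Fin N → ℝ) × (Fin N → ℝ)) := prior.map fun v => (v, v) with hΛ
  have hprob : IsProbabilityMeasure Λ := Measure.isProbabilityMeasure_map hd.aemeasurable
  have hfst : Λ.map Prod.fst = prior := by
    rw [Measure.map_map measurable_fst hd]; exact Measure.map_id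
  have hsnd : Λ.map Prod.snd = Measure.pi μ := by
    rw [Measure.map_map measurable_snd hd, ← hpi]; exact Measure.map_id
  have hdiag : ∀ᵐ ω ∂Λ, ω.1 = ω.2 :=
    (ae_map_iff hd.aemeasurable (measurableSet_eq_fun measurable_fst measurable_snd)).2
      (.of_forall fun _ => rfl)
  have hval : ∀ᵐ ω ∂Λ, ∀ i, ω.1 i ∈ Set.Icc 0 vbar :=
    ae_of_ae_map measurable_fst.aemeasurable (by rwa [hfst])
  have hbid : ∀ᵐ ω ∂Λ, (fun j => g (ω.2 j)) = ω.1 := by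
    filter_upwards [hdiag, hval] with ω h1 h2
    ext j
    rw [← h1]
    exact hgid _ (h2 j)
  have hrev : ∫ ω, secmax (fun j => g (ω.2 j)) ∂Λ = ∫ v, secmax v ∂prior := by
    rw [← hfst, integral_map measurable_fst.aemeasurable measurable_secmax.aestronglyMeasurable]
    refine integral_congr_ae ?_
    filter_upwards [hbid] with ω hω
    rw [hω]
  rw [← hrev]
  refine exists_equilibrium_of_real_signals hN hprior Λ hfst μ hsnd g hgm hgI (fun i s => s i)
    ?_ ?_ ?_ ?_ ?_
  · refine fun i => .of_bound (Measurable.aestronglyMeasurable (by fun_prop)) vbar ?_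
    filter_upwards [hdiag, hval] with ω h1 h2
    rw [← h1, Real.norm_eq_abs, abs_of_nonneg (h2 i).1]
    exact (h2 i).2
  · refine fun i X _ _ => integral_congr_ae ?_
    filter_upwards [hdiag] with ω hω
    rw [hω]
  · intro i
    filter_upwards [hbid, hdiag] with ω hω h2
    rw [hω, ← h2]
    exact le_alloc_mul_of_bid_eq hN i ω.1
  · filter_upwards [hbid] with ω hω
    rw [hω]
    simp only [alloc_mul_self, ← Finset.sum_mul, sum_alloc, one_mul]
  · intro i
    have hmap : Λ.map (fun ω => ω.2 i) = μ i := by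
      have h1 : Λ.map (fun ω => ω.2 i) = (Λ.map Prod.snd).map (Function.eval i) := by
        rw [Measure.map_map (measurable_pi_apply i) measurable_snd]; rfl
      rwa [hsnd, (measurePreserving_eval μ i).map_eq] at h1
    -- The signal is the value itself, so the posterior is a point mass at the signal.
    have h1 : condDistrib (fun ω => ω.1 i) (fun ω => ω.2 i) Λ =ᵐ[μ i] Kernel.id := by
      rw [condDistrib_congr (Y' := fun ω : (Fin N → ℝ) × (Fin N → ℝ) => ω.2 i)
        (by filter_upwards [hdiag] with ω hω; rw [hω]) Filter.EventuallyEq.rfl, ← hmap]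
      exact condDistrib_self _
    have h2 : ∀ᵐ s ∂μ i, s ∈ Set.Icc 0 vbar := by
      rw [← hmap]
      refine (ae_map_iff (Measurable.aemeasurable (by fun_prop)) measurableSet_Icc).2 ?_
      filter_upwards [hdiag, hval] with ω h1 h2
      rw [← h1]; exact h2 i
    filter_upwards [h1, h2] with s h1 h2
    rw [h1, hgid s h2, Kernel.id_apply, Measure.dirac_apply' _ measurableSet_Ici]
    simp

end FullInformation

/-! ### Tilted couplings of values and signals. -/

section Coupling

variable {α γ : Type*} [MeasurableSpace α] [MeasurableSpace γ] {μ : Measure α} {ν : Measure γ}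
  [SFinite μ] [SFinite ν] {f : α × γ → ENNReal}

/-- Tonelli: a density that integrates to one along almost every fibre does not disturb the
marginal. -/
lemma map_fst_withDensity (hf : Measurable f) (h : ∀ᵐ x ∂μ, ∫⁻ y, f (x, y) ∂ν = 1) :
    ((μ.prod ν).withDensity f).map Prod.fst = μ := by
  ext s hs
  rw [Measure.map_apply measurable_fst hs, withDensity_apply _ (measurable_fst hs),
    ← Set.prod_univ, setLIntegral_prod _ hf.aemeasurable]
  simp only [Measure.restrict_univ]
  rw [lintegral_congr_ae (ae_restrict_of_ae h)]
  simp

lemma map_snd_withDensity (hf : Measurable f) (h : ∀ᵐ y ∂ν, ∫⁻ x, f (x, y) ∂μ = 1) :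
    ((μ.prod ν).withDensity f).map Prod.snd = ν := by
  ext s hs
  rw [Measure.map_apply measurable_snd hs, withDensity_apply _ (measurable_snd hs),
    ← Set.univ_prod, setLIntegral_prod_symm _ hf.aemeasurable]
  simp only [Measure.restrict_univ]
  rw [lintegral_congr_ae (ae_restrict_of_ae h)]
  simp

variable {N : ℕ}

/-- The density of a coupling of two profiles whose highest bidders coincide, tilted so that
the statistics `T` and `q` of the two profiles are positively correlated. -/
def couplingDensity (T q : (Fin N → ℝ) → ℝ) (κ : ℝ) (p : (Fin N → ℝ) × (Fin N → ℝ)) : ℝ :=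
  ∑ j, N * alloc j p.2 * (alloc j p.1 * (1 + κ * T p.1 * q p.2))

/-- Values and signals play interchangeable roles, so one fibre computation yields both marginals.
-/
lemma couplingDensity_swap (T q : (Fin N → ℝ) → ℝ) (κ : ℝ) (v u : Fin N → ℝ) :
    couplingDensity T q κ (v, u) = couplingDensity q T κ (u, v) :=
  Finset.sum_congr rfl fun j _ => by ring

lemma measurable_couplingDensity {T q : (Fin N → ℝ) → ℝ} (hT : Measurable T) (hq : Measurable q)
    (κ : ℝ) : Measurable (couplingDensity T q κ) := by
  unfold couplingDensity
  fun_prop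

lemma couplingDensity_nonneg {T q : (Fin N → ℝ) → ℝ} {κ : ℝ} (h0 : 0 ≤ κ) (h1 : κ ≤ 1)
    {v u : Fin N → ℝ} (hT : |T v| ≤ 1) (hq : |q u| ≤ 1) : 0 ≤ couplingDensity T q κ (v, u) := by
  refine Finset.sum_nonneg fun j _ => ?_
  have h2 : |κ * T v * q u| ≤ 1 := by
    rw [abs_mul, abs_mul, abs_of_nonneg h0]
    exact mul_le_one₀ (mul_le_one₀ h1 (abs_nonneg _) hT) (abs_nonneg _) hq
  have h3 := (abs_le.1 h2).1
  have := alloc_nonneg j u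
  have := alloc_nonneg j v
  have : 0 ≤ 1 + κ * T v * q u := by linarith
  dsimp only
  positivity

/-- The data of a bounded symmetric statistic of mean zero of an exchangeable profile. -/
structure IsTilt (Q : Measure (Fin N → ℝ)) (T : (Fin N → ℝ) → ℝ) : Prop where
  exch : IsExchangeable Q
  meas : Measurable T
  symm : ∀ (τ : Equiv.Perm (Fin N)) v, T (fun i => v (τ i)) = T v
  bound : ∀ᵐ v ∂Q, |T v| ≤ 1
  mean : ∫ v, T v ∂Q = 0

namespace IsTilt

variable {Q U : Measure (Fin N → ℝ)} [IsProbabilityMeasure Q] [IsProbabilityMeasure U]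
  {T q : (Fin N → ℝ) → ℝ} {κ : ℝ}

omit [IsProbabilityMeasure Q] in
lemma integrable_mul (hT : IsTilt Q T) {g : (Fin N → ℝ) → ℝ} (hg : Integrable g Q) (c : ℝ) :
    Integrable (fun v => g v * (1 + κ * T v * c)) Q := by
  have h1 : Integrable (fun v => T v * g v) Q :=
    hg.bdd_mul (c := 1) hT.meas.aestronglyMeasurable (by simpa using hT.bound)
  refine (hg.add (h1.const_mul (κ * c))).congr (.of_forall fun v => ?_)
  simp only [Pi.add_apply]
  ring

omit [IsProbabilityMeasure Q] in
lemma integrable_alloc_mul (hT : IsTilt Q T) {g : (Fin N → ℝ) → ℝ} (hg : Integrable g Q) (c : ℝ)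
    (j : Fin N) : Integrable (fun v => alloc j v * (g v * (1 + κ * T v * c))) Q :=
  (hT.integrable_mul hg c).bdd_mul (c := 1) (measurable_alloc j).aestronglyMeasurable
    (.of_forall fun v => by simpa using abs_alloc_le_one j v)

omit [IsProbabilityMeasure Q] in
lemma integral_mul (hT : IsTilt Q T) {g : (Fin N → ℝ) → ℝ} (hg : Integrable g Q) (c : ℝ) :
    ∫ v, g v * (1 + κ * T v * c) ∂Q = ∫ v, g v ∂Q + κ * c * ∫ v, T v * g v ∂Q := by
  have h1 : Integrable (fun v => T v * g v) Q :=
    hg.bdd_mul (c := 1) hT.meas.aestronglyMeasurable (by simpa using hT.bound)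
  rw [← integral_const_mul, ← integral_add hg (h1.const_mul _)]
  congr 1; ext v; ring

/-- By exchangeability, being told that `j` is highest does not change the law of a symmetric
statistic. With `c = q u`, taking `g = maxEntry` gives the winner's expected value and `g = secmax`
bounds a loser's. -/
lemma integral_alloc_mul (hT : IsTilt Q T) {g : (Fin N → ℝ) → ℝ} (hgm : Measurable g)
    (hg : Integrable g Q) (hs : ∀ (τ : Equiv.Perm (Fin N)) v, g (fun i => v (τ i)) = g v) (c : ℝ)
    (j : Fin N) : N * ∫ v, alloc j v * (g v * (1 + κ * T v * c)) ∂Q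
      = ∫ v, g v ∂Q + κ * c * ∫ v, T v * g v ∂Q := by
  have hTm := hT.meas
  rw [← hT.integral_mul hg c]
  exact hT.exch.integral_alloc_mul (f := fun v => g v * (1 + κ * T v * c)) (by fun_prop)
    (hT.integrable_mul hg c) (fun τ v => by simp only [hs, hT.symm]) j

lemma integrable_couplingDensity (hT : IsTilt Q T) {g : (Fin N → ℝ) → ℝ} (hg : Integrable g Q)
    (u : Fin N → ℝ) : Integrable (fun v => couplingDensity T q κ (v, u) * g v) Q := by
  have : ∀ j, Integrable (fun v => N * alloc j u * (alloc j v * (g v * (1 + κ * T v * q u)))) Q :=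
    fun j => (hT.integrable_alloc_mul hg (q u) j).const_mul _
  refine (integrable_finsetSum Finset.univ fun j _ => this j).congr (.of_forall fun v => ?_)
  simp only [couplingDensity, Finset.sum_mul]
  exact Finset.sum_congr rfl fun j _ => by ring

lemma integral_couplingDensity_mul (hT : IsTilt Q T) {g : (Fin N → ℝ) → ℝ} (hg : Integrable g Q)
    (u : Fin N → ℝ) : ∫ v, couplingDensity T q κ (v, u) * g v ∂Q
      = ∑ j, alloc j u * (N * ∫ v, alloc j v * (g v * (1 + κ * T v * q u)) ∂Q) := by
  have : ∀ j, Integrable (fun v => N * alloc j u * (alloc j v * (g v * (1 + κ * T v * q u)))) Q :=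
    fun j => (hT.integrable_alloc_mul hg (q u) j).const_mul _
  calc _ = ∫ v, ∑ j, N * alloc j u * (alloc j v * (g v * (1 + κ * T v * q u))) ∂Q := by
        congr 1; ext v
        simp only [couplingDensity, Finset.sum_mul]
        exact Finset.sum_congr rfl fun j _ => by ring
    _ = _ := by
        rw [integral_finsetSum _ fun j _ => this j]
        refine Finset.sum_congr rfl fun j _ => ?_
        rw [integral_const_mul]; ring

/-- The factor `N` offsets each bidder's chance `1 / N` of being allocated the good, and the tilt
drops out because `T` has mean zero. -/
lemma integral_couplingDensity [Nonempty (Fin N)] (hT : IsTilt Q T) (u : Fin N → ℝ) :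
    ∫ v, couplingDensity T q κ (v, u) ∂Q = 1 := by
  have h := hT.integral_couplingDensity_mul (q := q) (κ := κ) (integrable_const (1 : ℝ)) u
  simp only [mul_one] at h
  rw [h]
  have h2 := fun j => hT.integral_alloc_mul (κ := κ) measurable_const (integrable_const (1 : ℝ))
    (fun _ _ => rfl) (q u) j
  simp only [h2]
  simp [hT.mean, sum_alloc]

lemma lintegral_couplingDensity [Nonempty (Fin N)] (hT : IsTilt Q T) (h0 : 0 ≤ κ) (h1 : κ ≤ 1)
    {u : Fin N → ℝ} (hu : |q u| ≤ 1) :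
    ∫⁻ v, ENNReal.ofReal (couplingDensity T q κ (v, u)) ∂Q = 1 := by
  have hi : Integrable (fun v => couplingDensity T q κ (v, u)) Q := by
    simpa using hT.integrable_couplingDensity (q := q) (κ := κ) (integrable_const (1 : ℝ)) u
  rw [← ofReal_integral_eq_lintegral_ofReal hi, hT.integral_couplingDensity, ENNReal.ofReal_one]
  filter_upwards [hT.bound] with v hv
  exact couplingDensity_nonneg h0 h1 hv hu

end IsTilt

/-- The coupling of `Q` and `U` with density `couplingDensity T q κ`. -/
def couplingLaw (Q U : Measure (Fin N → ℝ)) (T q : (Fin N → ℝ) → ℝ) (κ : ℝ) :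
    Measure ((Fin N → ℝ) × (Fin N → ℝ)) :=
  (Q.prod U).withDensity fun p => ENNReal.ofReal (couplingDensity T q κ p)

section CouplingLaw

variable {Q U : Measure (Fin N → ℝ)} [IsProbabilityMeasure Q] [IsProbabilityMeasure U]
  {T q : (Fin N → ℝ) → ℝ} {κ : ℝ}

lemma map_snd_couplingLaw [Nonempty (Fin N)] (hT : IsTilt Q T) (hq : IsTilt U q) (h0 : 0 ≤ κ)
    (h1 : κ ≤ 1) : (couplingLaw Q U T q κ).map Prod.snd = U :=
  map_snd_withDensity (measurable_couplingDensity hT.meas hq.meas κ).ennreal_ofReal (by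
    filter_upwards [hq.bound] with u hu
    exact hT.lintegral_couplingDensity h0 h1 hu)

lemma map_fst_couplingLaw [Nonempty (Fin N)] (hT : IsTilt Q T) (hq : IsTilt U q) (h0 : 0 ≤ κ)
    (h1 : κ ≤ 1) : (couplingLaw Q U T q κ).map Prod.fst = Q :=
  map_fst_withDensity (measurable_couplingDensity hT.meas hq.meas κ).ennreal_ofReal (by
    filter_upwards [hT.bound] with v hv
    simp only [couplingDensity_swap T q]
    exact hq.lintegral_couplingDensity h0 h1 hv)

lemma isProbabilityMeasure_couplingLaw [Nonempty (Fin N)] (hT : IsTilt Q T) (hq : IsTilt U q)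
    (h0 : 0 ≤ κ) (h1 : κ ≤ 1) : IsProbabilityMeasure (couplingLaw Q U T q κ) := by
  refine ⟨?_⟩
  have h := congrArg (fun m => m Set.univ) (map_snd_couplingLaw hT hq h0 h1)
  simpa [Measure.map_apply measurable_snd MeasurableSet.univ] using h

omit [IsProbabilityMeasure Q] [IsProbabilityMeasure U] in
lemma ae_couplingDensity_nonneg (hT : IsTilt Q T) (hq : IsTilt U q) (h0 : 0 ≤ κ) (h1 : κ ≤ 1) :
    ∀ᵐ p ∂Q.prod U, 0 ≤ couplingDensity T q κ p := by
  filter_upwards [Measure.quasiMeasurePreserving_fst.ae hT.bound,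
    Measure.quasiMeasurePreserving_snd.ae hq.bound] with p hp hp'
  exact couplingDensity_nonneg h0 h1 hp hp'

/-- Integrals against the coupling law are computed by conditioning on the second profile. -/
lemma integral_couplingLaw_mul [Nonempty (Fin N)] (hT : IsTilt Q T) (hq : IsTilt U q)
    (h0 : 0 ≤ κ) (h1 : κ ≤ 1) {g : (Fin N → ℝ) → ℝ} (hgm : Measurable g) {C : ℝ}
    (hg : ∀ᵐ v ∂Q, |g v| ≤ C) {X : (Fin N → ℝ) → ℝ} (hX : Measurable X) (hX1 : ∀ u, |X u| ≤ 1) :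
    ∫ ω, X ω.2 * g ω.1 ∂couplingLaw Q U T q κ
      = ∫ ω, X ω.2 * ∫ v, couplingDensity T q κ (v, ω.2) * g v ∂Q ∂couplingLaw Q U T q κ := by
  have hρm := measurable_couplingDensity hT.meas hq.meas κ
  have hprob := isProbabilityMeasure_couplingLaw hT hq h0 h1
  have hfst := map_fst_couplingLaw hT hq h0 h1
  have hsnd := map_snd_couplingLaw hT hq h0 h1
  have hnn := ae_couplingDensity_nonneg hT hq h0 h1
  have hwm : Measurable fun u => ∫ v, couplingDensity T q κ (v, u) * g v ∂Q :=
    (StronglyMeasurable.integral_prod_left'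
      (f := fun p : (Fin N → ℝ) × (Fin N → ℝ) => couplingDensity T q κ p * g p.1)
      (hρm.mul (hgm.comp measurable_fst)).stronglyMeasurable).measurable
  -- The density is integrable because the coupling law has total mass one.
  have hρ1 : Integrable (couplingDensity T q κ) (Q.prod U) := by
    refine ⟨hρm.aestronglyMeasurable, ?_⟩
    rw [hasFiniteIntegral_iff_ofReal hnn]
    have := hprob.measure_univ
    rw [couplingLaw, withDensity_apply _ .univ, Measure.restrict_univ] at this
    rw [this]
    exact ENNReal.one_lt_top
  have hint : Integrable (fun p : (Fin N → ℝ) × (Fin N → ℝ) =>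
      X p.2 * (couplingDensity T q κ p * g p.1)) (Q.prod U) := by
    refine ((hρ1.mul_bdd (c := C) (hgm.comp measurable_fst).aestronglyMeasurable ?_).bdd_mul
      (c := 1) (hX.comp measurable_snd).aestronglyMeasurable (.of_forall fun p => hX1 _))
    exact Measure.quasiMeasurePreserving_fst.ae hg
  have h2 := integral_map (μ := couplingLaw Q U T q κ) measurable_snd.aemeasurable
    (f := fun u => X u * ∫ v, couplingDensity T q κ (v, u) * g v ∂Q)
    (hX.mul hwm).aestronglyMeasurable
  rw [← h2, hsnd, couplingLaw, integral_withDensity_eq_integral_toReal_smul hρm.ennreal_ofReal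
    (.of_forall fun _ => ENNReal.ofReal_lt_top)]
  calc _ = ∫ p, X p.2 * (couplingDensity T q κ p * g p.1) ∂Q.prod U := by
        refine integral_congr_ae ?_
        filter_upwards [hnn] with p hp
        rw [ENNReal.toReal_ofReal hp, smul_eq_mul]; ring
    _ = _ := by
        rw [integral_prod_symm _ hint]
        simp only [integral_const_mul]

/-- The integral is an average of `g` with weights of total mass one, so it inherits the bound `C`.
-/
lemma integrable_condValue [Nonempty (Fin N)] (hT : IsTilt Q T) (hq : IsTilt U q)
    (h0 : 0 ≤ κ) (h1 : κ ≤ 1) {g : (Fin N → ℝ) → ℝ} (hgm : Measurable g) {C : ℝ}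
    (hg : ∀ᵐ v ∂Q, |g v| ≤ C) :
    Integrable (fun ω => ∫ v, couplingDensity T q κ (v, ω.2) * g v ∂Q)
      (couplingLaw Q U T q κ) := by
  have hρm := measurable_couplingDensity hT.meas hq.meas κ
  have hprob := isProbabilityMeasure_couplingLaw hT hq h0 h1
  have hsnd := map_snd_couplingLaw hT hq h0 h1
  have hwm : Measurable fun u => ∫ v, couplingDensity T q κ (v, u) * g v ∂Q :=
    (StronglyMeasurable.integral_prod_left'
      (f := fun p : (Fin N → ℝ) × (Fin N → ℝ) => couplingDensity T q κ p * g p.1)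
      (hρm.mul (hgm.comp measurable_fst)).stronglyMeasurable).measurable
  refine .of_bound (hwm.comp measurable_snd).aestronglyMeasurable C ?_
  have hb : ∀ᵐ ω ∂couplingLaw Q U T q κ, |q ω.2| ≤ 1 :=
    ae_of_ae_map measurable_snd.aemeasurable (by rw [hsnd]; exact hq.bound)
  filter_upwards [hb] with ω hω
  have hi : Integrable (fun v => couplingDensity T q κ (v, ω.2)) Q := by
    simpa using hT.integrable_couplingDensity (q := q) (κ := κ) (integrable_const (1 : ℝ)) ω.2
  calc _ ≤ ∫ v, couplingDensity T q κ (v, ω.2) * C ∂Q := by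
        refine norm_integral_le_of_norm_le (hi.mul_const C) ?_
        filter_upwards [hT.bound, hg] with v hv hgv
        have := couplingDensity_nonneg h0 h1 hv hω
        rw [norm_mul, Real.norm_eq_abs, Real.norm_eq_abs, abs_of_nonneg this]
        gcongr
    _ = C := by rw [integral_mul_const, hT.integral_couplingDensity, one_mul]

end CouplingLaw

end Coupling

/-! ### Uniform signals: no ties, and posteriors that never exclude high values. -/

section UniformSignals

variable {N : ℕ}

/-- The uniform law on the unit interval. -/
def unitUniform : Measure ℝ := volume.restrict (Set.Icc 0 1)

instance : IsProbabilityMeasure unitUniform := ⟨by simp [unitUniform]⟩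

instance : NullSingletonClass unitUniform := inferInstanceAs (NullSingletonClass (volume.restrict _))

lemma ae_pi_unitUniform_mem_Icc :
    ∀ᵐ u ∂Measure.pi fun _ : Fin N => unitUniform, ∀ i, u i ∈ Set.Icc (0 : ℝ) 1 := by
  rw [ae_all_iff]
  intro i
  exact (Measure.quasiMeasurePreserving_eval (fun _ : Fin N => unitUniform) i).ae
    (ae_restrict_mem measurableSet_Icc)

/-- Two coordinates have joint law `ν.prod ν`, and by Fubini an atomless `ν` gives the diagonal no
mass. -/
lemma ae_pi_injective (ν : Measure ℝ) [IsProbabilityMeasure ν] [NullSingletonClass ν] :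
    ∀ᵐ u ∂Measure.pi fun _ : Fin N => ν, ∀ i j, i ≠ j → u i ≠ u j := by
  rw [ae_all_iff]; intro i
  rw [ae_all_iff]; intro j
  by_cases hij : i = j
  · exact .of_forall fun u h => absurd hij h
  have hind : IndepFun (fun u : Fin N → ℝ => u i) (fun u => u j)
      (Measure.pi fun _ : Fin N => ν) :=
    (iIndepFun_pi (X := fun _ : Fin N => (id : ℝ → ℝ)) fun _ => aemeasurable_id).indepFun hij
  rw [indepFun_iff_map_prod_eq_prod_map_map (measurable_pi_apply i).aemeasurable
    (measurable_pi_apply j).aemeasurable] at hind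
  have hm : ∀ k, (Measure.pi fun _ : Fin N => ν).map (fun u => u k) = ν := fun k =>
    (measurePreserving_eval (fun _ : Fin N => ν) k).map_eq
  rw [hm, hm] at hind
  have h : ∀ᵐ p ∂ν.prod ν, p.1 ≠ p.2 := by
    refine (Measure.ae_prod_iff_ae_ae (p := fun p : ℝ × ℝ => p.1 ≠ p.2)
      (measurableSet_eq_fun measurable_fst measurable_snd).compl).2 ?_
    refine .of_forall fun x => ?_
    have : ∀ᵐ y ∂ν, y ≠ x := by simp [ae_iff]
    filter_upwards [this] with y hy using hy.symm
  rw [← hind] at h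
  filter_upwards [ae_of_ae_map (by fun_prop) h] with u hu _ using hu

/-- A set of signals that bidder `i` almost never has while having the highest signal is
negligible. -/
lemma unitUniform_eq_zero_of_highest {A : Set ℝ} (i : Fin N)
    (h : (Measure.pi fun _ : Fin N => unitUniform) {u | u i ∈ A ∧ ∀ j, u j ≤ u i} = 0) :
    unitUniform A = 0 := by
  have h1 : ∀ n : ℕ, unitUniform (A ∩ Set.Ioi (1 / (n + 1 : ℝ))) = 0 := fun n => by
    set ε : ℝ := 1 / (n + 1 : ℝ) with hε
    have hε0 : 0 < ε := by positivity
    set s : Fin N → Set ℝ := Function.update (fun _ => Set.Iic ε) i (A ∩ Set.Ioi ε) with hs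
    -- In this box `i` has a signal in `A` above `ε` and all others are at most `ε`, so `i` is
    -- highest. Its measure is a product whose other factors are positive, which forces the factor
    -- of `i` to vanish.
    have hbox : (Measure.pi fun _ : Fin N => unitUniform) (Set.univ.pi s) = 0 := by
      refine measure_mono_null (fun u hu => ?_) h
      have hi : u i ∈ A ∩ Set.Ioi ε := by simpa [hs] using hu i (Set.mem_univ i)
      refine ⟨hi.1, fun j => ?_⟩
      by_cases hj : j = i
      · simp [hj]
      · have : u j ≤ ε := by simpa [hs, hj] using hu j (Set.mem_univ j)
        exact this.trans (le_of_lt hi.2)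
    rw [Measure.pi_pi, Finset.prod_eq_zero_iff] at hbox
    obtain ⟨j, -, hj⟩ := hbox
    by_cases hji : j = i
    · subst hji; simpa [hs] using hj
    · exfalso
      have h2 : Set.Icc 0 (min ε 1) ⊆ Set.Iic ε ∩ Set.Icc 0 1 := fun x hx =>
        ⟨hx.2.trans (min_le_left _ _), hx.1, hx.2.trans (min_le_right _ _)⟩
      have h3 : volume (Set.Icc 0 (min ε 1)) = 0 := by
        refine measure_mono_null h2 ?_
        have h4 : unitUniform (Set.Iic ε) = 0 := by simpa [hs, hji] using hj
        rwa [unitUniform, Measure.restrict_apply measurableSet_Iic] at h4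
      rw [Real.volume_Icc, ENNReal.ofReal_eq_zero] at h3
      have : 0 < min ε 1 := lt_min hε0 one_pos
      linarith
  -- The sets with signals above `1 / (n + 1)` exhaust only the positive part of `A`.
  have h0 : unitUniform (Set.Iic 0) = 0 := by
    rw [unitUniform, Measure.restrict_apply measurableSet_Iic]
    refine measure_mono_null (t := {0}) (fun x hx => le_antisymm hx.1 hx.2.1) (by simp)
  refine measure_mono_null (t := Set.Iic 0 ∪ ⋃ n : ℕ, A ∩ Set.Ioi (1 / (n + 1 : ℝ))) ?_
    (measure_union_null h0 (measure_iUnion_null h1))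
  intro x hx
  rcases le_or_gt x 0 with hx0 | hx0
  · exact Or.inl hx0
  · obtain ⟨n, hn⟩ := exists_nat_one_div_lt hx0
    exact Or.inr (Set.mem_iUnion.2 ⟨n, hx, hn⟩)

lemma IsExchangeable.measure_comp {Q : Measure (Fin N → ℝ)} (hQ : IsExchangeable Q)
    (τ : Equiv.Perm (Fin N)) {s : Set (Fin N → ℝ)} (hs : MeasurableSet s) :
    Q {v | (fun i => v (τ i)) ∈ s} = Q s := by
  conv_rhs => rw [← hQ τ]
  rw [Measure.map_apply (measurable_pi_lambda _ fun i => measurable_pi_apply _) hs]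
  rfl

/-- If the event were null for `i`, swapping bidders would make it null for all, yet these events
cover `{v | c ≤ maxEntry v}`. -/
lemma IsExchangeable.measure_highest_ne_zero {Q : Measure (Fin N → ℝ)} [Nonempty (Fin N)]
    (hQ : IsExchangeable Q) {c : ℝ} (hc : Q {v | c ≤ maxEntry v} ≠ 0) (i : Fin N) :
    Q {v | c ≤ v i ∧ ∀ j, v j ≤ v i} ≠ 0 := by
  have hm : ∀ k : Fin N, MeasurableSet {v : Fin N → ℝ | c ≤ v k ∧ ∀ j, v j ≤ v k} := fun k =>
    (measurableSet_le measurable_const (measurable_pi_apply k)).inter (measurableSet_highest k)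
  intro h0
  refine hc (measure_mono_null (t := ⋃ k, {v | c ≤ v k ∧ ∀ j, v j ≤ v k}) ?_ ?_)
  · intro v hv
    obtain ⟨k, hk⟩ := exists_eq_maxEntry v
    exact Set.mem_iUnion.2 ⟨k, by rw [hk]; exact hv, fun j => hk ▸ le_maxEntry v j⟩
  · refine measure_iUnion_null fun k => ?_
    rw [← hQ.measure_comp (Equiv.swap i k) (hm k)]
    refine measure_mono_null (fun v hv => ?_) h0
    obtain ⟨h1, h2⟩ := hv
    simp only [Equiv.swap_apply_right] at h1 h2
    exact ⟨h1, fun j => by simpa using h2 (Equiv.swap i k j)⟩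

/-- Whatever her signal, bidder `i` deems it possible that her value exceeds `c`, if the highest
value can exceed `c`. -/
lemma ae_condDistrib_couplingLaw_pos [Nonempty (Fin N)] {Q : Measure (Fin N → ℝ)}
    [IsProbabilityMeasure Q] {T q : (Fin N → ℝ) → ℝ} {κ : ℝ} (hT : IsTilt Q T)
    (hq : IsTilt (Measure.pi fun _ : Fin N => unitUniform) q) (h0 : 0 ≤ κ) (h1 : κ < 1)
    [IsProbabilityMeasure (couplingLaw Q (Measure.pi fun _ : Fin N => unitUniform) T q κ)]
    {c : ℝ} (hc : Q {v | c ≤ maxEntry v} ≠ 0) (i : Fin N) :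
    ∀ᵐ s ∂unitUniform, 0 < condDistrib (fun ω => ω.1 i) (fun ω => ω.2 i)
      (couplingLaw Q (Measure.pi fun _ : Fin N => unitUniform) T q κ) s (Set.Ici c) := by
  set U := Measure.pi fun _ : Fin N => unitUniform with hU
  set Λ := couplingLaw Q U T q κ with hΛ
  set K := condDistrib (fun ω : (Fin N → ℝ) × (Fin N → ℝ) => ω.1 i) (fun ω => ω.2 i) Λ with hK
  set A : Set ℝ := {s | K s (Set.Ici c) = 0} with hA
  have hAm : MeasurableSet A := (K.measurable_coe measurableSet_Ici) (measurableSet_singleton 0)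
  have hv : Measurable fun ω : (Fin N → ℝ) × (Fin N → ℝ) => ω.1 i := by fun_prop
  have hs : Measurable fun ω : (Fin N → ℝ) × (Fin N → ℝ) => ω.2 i := by fun_prop
  have hΛ0 : Λ ((fun ω => ω.2 i) ⁻¹' A ∩ (fun ω => ω.1 i) ⁻¹' Set.Ici c) = 0 := by
    rw [← setLIntegral_preimage_condDistrib hs hv.aemeasurable measurableSet_Ici hAm]
    refine (setLIntegral_congr_fun (hs hAm) (g := fun _ => 0) fun ω hω => hω).trans (by simp)
  have hρm := measurable_couplingDensity hT.meas hq.meas κ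
  rw [hΛ, couplingLaw, withDensity_apply_eq_zero' hρm.ennreal_ofReal.aemeasurable] at hΛ0
  -- Where `i` is highest in both profiles the coupling density is positive, so a null event of the
  -- coupling law is there null for the product law as well.
  have hprod : (Q.prod U) ({v | c ≤ v i ∧ ∀ j, v j ≤ v i} ×ˢ {u | u i ∈ A ∧ ∀ j, u j ≤ u i})
      = 0 := by
    have hae : ∀ᵐ p ∂Q.prod U, |T p.1| ≤ 1 ∧ |q p.2| ≤ 1 := by
      filter_upwards [Measure.quasiMeasurePreserving_fst.ae hT.bound,
        Measure.quasiMeasurePreserving_snd.ae hq.bound] with p hp hp' using ⟨hp, hp'⟩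
    refine measure_mono_null ?_ (measure_union_null hΛ0 (ae_iff.1 hae))
    rintro ⟨v, u⟩ ⟨⟨hv1, hv2⟩, hu1, hu2⟩
    by_cases hb : |T v| ≤ 1 ∧ |q u| ≤ 1
    · refine Or.inl ⟨?_, hu1, hv1⟩
      -- The factor is at least `1 - κ`; strict positivity is where `κ < 1` matters.
      have hterm : 0 < 1 + κ * T v * q u := by
        have h2 : |κ * T v * q u| ≤ κ := by
          rw [abs_mul, abs_mul, abs_of_nonneg h0, mul_assoc]
          exact mul_le_of_le_one_right h0 (mul_le_one₀ hb.1 (abs_nonneg _) hb.2)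
        linarith [(abs_le.1 h2).1]
      have hpos : 0 < couplingDensity T q κ (v, u) := by
        refine Finset.sum_pos' (fun j _ => ?_) ⟨i, Finset.mem_univ i, ?_⟩
        · exact mul_nonneg (mul_nonneg (Nat.cast_nonneg _) (alloc_nonneg j u))
            (mul_nonneg (alloc_nonneg j v) hterm.le)
        · have hN : (0 : ℝ) < N := Nat.cast_pos.2 i.pos
          exact mul_pos (mul_pos hN (alloc_pos hu2)) (mul_pos (alloc_pos hv2) hterm)
      simpa using hpos
    · exact Or.inr hb
  rw [Measure.prod_prod, mul_eq_zero] at hprod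
  have hA0 := unitUniform_eq_zero_of_highest i
    (hprod.resolve_left (hT.exch.measure_highest_ne_zero hc i))
  filter_upwards [compl_mem_ae_iff.2 hA0] with s hs
  exact pos_iff_ne_zero.2 hs

end UniformSignals

/-! ### Choice of parameters and verification of the coupled equilibrium. -/

section Construction

variable {N : ℕ} {prior : Measure (Fin N → ℝ)} {vbar : ℝ}

/-- A variable that never exceeds its mean equals it almost surely. The gap between the mean and `c`
leaves room for bids slightly above the mean without overbidding. -/
lemma exists_pos_measure_le_maxEntry [IsProbabilityMeasure prior]
    (hint : Integrable (maxEntry (N := N)) prior)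
    (hne : ¬ ∀ᵐ v ∂prior, maxEntry v = maxWelfare prior) :
    ∃ c, maxWelfare prior < c ∧ prior {v | c ≤ maxEntry v} ≠ 0 := by
  by_contra! hcon
  refine hne ?_
  have h1 : ∀ᵐ v ∂prior, maxEntry v ≤ maxWelfare prior := by
    have h2 : ∀ᵐ v ∂prior, ∀ n : ℕ, maxEntry v < maxWelfare prior + 1 / (n + 1 : ℝ) := by
      rw [ae_all_iff]
      intro n
      have := hcon (maxWelfare prior + 1 / (n + 1 : ℝ)) (lt_add_of_pos_right _ (by positivity))
      simpa [ae_iff] using this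
    filter_upwards [h2] with v hv
    by_contra! hlt
    obtain ⟨n, hn⟩ := exists_nat_one_div_lt (sub_pos.2 hlt)
    linarith [hv n]
  have h3 : ∫ v, (maxWelfare prior - maxEntry v) ∂prior = 0 := by
    rw [integral_sub (integrable_const _) hint]
    simp [maxWelfare]
  rw [integral_eq_zero_iff_of_nonneg_ae (f := fun v => maxWelfare prior - maxEntry v) (by filter_upwards [h1] with v hv using sub_nonneg.2 hv)
    ((integrable_const _).sub hint)] at h3
  filter_upwards [h3] with v hv
  have : maxWelfare prior - maxEntry v = 0 := hv
  linarith

/-- With exchangeable independent values, a constant highest value forces all values to be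
constant. -/
lemma fullInfoSurplus_eq_zero [IsProbabilityMeasure prior] (hN : 2 ≤ N)
    (hsymm : IsExchangeable prior) (hprod : IsProductPrior prior)
    (h : ∀ᵐ v ∂prior, maxEntry v = maxWelfare prior) : fullInfoSurplus prior = 0 := by
  have : Nonempty (Fin N) := ⟨⟨0, by omega⟩⟩
  set m := maxWelfare prior with hm
  have hi : ∃ i, prior {v | v i ∈ Set.Iio m} = 0 := by
    obtain ⟨μ, hμ, hpi⟩ := hprod
    -- The highest value is almost never below `m`, so by independence the chances of the single
    -- values being below `m` have product zero, and one of them is zero. Symmetry passes this on to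
    -- every bidder.
    have h0 : prior (Set.univ.pi fun _ => Set.Iio m) = 0 := by
      refine measure_mono_null (fun v hv => ?_) (ae_iff.1 h)
      obtain ⟨i, hi⟩ := exists_eq_maxEntry v
      have : v i < m := hv i (Set.mem_univ i)
      exact fun he => absurd (hi.trans he) this.ne
    rw [hpi, Measure.pi_pi, Finset.prod_eq_zero_iff] at h0
    obtain ⟨i, -, hi⟩ := h0
    refine ⟨i, ?_⟩
    rw [← (measurePreserving_eval μ i).measure_preimage measurableSet_Iio.nullMeasurableSet,
      ← hpi] at hi
    exact hi
  obtain ⟨i, hi⟩ := hi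
  have hall : ∀ᵐ v ∂prior, ∀ j, m ≤ v j := by
    rw [ae_all_iff]
    intro j
    have hj : prior {v | v j ∈ Set.Iio m} = 0 := by
      have hmeas : MeasurableSet {v : Fin N → ℝ | v j ∈ Set.Iio m} :=
        measurable_pi_apply j measurableSet_Iio
      rw [← hsymm.measure_comp (Equiv.swap i j) hmeas]
      simpa using hi
    filter_upwards [compl_mem_ae_iff.2 hj] with v hv
    exact not_lt.1 hv
  refine integral_eq_zero_of_ae ?_
  filter_upwards [h, hall] with v hv h2
  have h3 := (secmax_mem_Icc hN (x := v) (a := m) (c := m) fun j =>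
    ⟨h2 j, hv ▸ le_maxEntry v j⟩).1
  have h4 := secmax_le_maxEntry hN v
  simp only [Pi.zero_apply]
  linarith

/-- Every revenue above the full-information revenue, up to the maximal welfare, is attained with
an efficient allocation. -/
theorem exists_equilibrium_couplingLaw [IsProbabilityMeasure prior] (hN : 2 ≤ N)
    (hv1 : vbar ≤ 1) (hprior : ∀ᵐ v ∂prior, ∀ i, v i ∈ Set.Icc 0 vbar)
    (hsymm : IsExchangeable prior) (hne : ¬ ∀ᵐ v ∂prior, maxEntry v = maxWelfare prior)
    {R : ℝ} (hR : ∫ v, secmax v ∂prior < R) (hRm : R ≤ maxWelfare prior) :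
    ∃ I : InfoStructure prior, I.IsPrivatePrivate ∧
      ∃ σ : I.Profile vbar, I.IsEquilibrium σ ∧ I.NoOverbidding σ ∧
        I.revenue σ = R ∧
        I.totalBidderSurplus σ + I.revenue σ = maxWelfare prior := by
  have : Nonempty (Fin N) := ⟨⟨0, by omega⟩⟩
  set m := maxWelfare prior with hm
  set e := ∫ v, secmax v ∂prior with he
  set U := Measure.pi fun _ : Fin N => unitUniform with hU
  set p := ∫ u, secmax u ∂U with hp
  have hMI : ∀ᵐ v ∂prior, maxEntry v ∈ Set.Icc 0 vbar := by
    filter_upwards [hprior] with v hv using maxEntry_mem_Icc hv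
  have hSI : ∀ᵐ v ∂prior, secmax v ∈ Set.Icc 0 vbar := by
    filter_upwards [hprior] with v hv using secmax_mem_Icc hN hv
  have hsI : ∀ᵐ u ∂U, secmax u ∈ Set.Icc (0 : ℝ) 1 := by
    filter_upwards [ae_pi_unitUniform_mem_Icc] with u hu using secmax_mem_Icc hN hu
  have habs : ∀ {x c : ℝ}, x ∈ Set.Icc 0 c → ‖x‖ ≤ c := fun hx => by
    rw [Real.norm_eq_abs, abs_of_nonneg hx.1]; exact hx.2
  have hMint : Integrable (maxEntry (N := N)) prior :=
    .of_bound measurable_maxEntry.aestronglyMeasurable vbar (hMI.mono fun _ hv => habs hv)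
  have hSint : Integrable (secmax (N := N)) prior :=
    .of_bound measurable_secmax.aestronglyMeasurable vbar (hSI.mono fun _ hv => habs hv)
  have hsint : Integrable (secmax (N := N)) U :=
    .of_bound measurable_secmax.aestronglyMeasurable 1 (hsI.mono fun _ hv => habs hv)
  have hm0 : 0 ≤ m := integral_nonneg_of_ae (hMI.mono fun _ hv => hv.1)
  have hm1 : m ≤ 1 := by
    calc m ≤ ∫ _, (1 : ℝ) ∂prior :=
          integral_mono_ae hMint (integrable_const _) (hMI.mono fun _ hv => hv.2.trans hv1)
      _ = 1 := by simp
  have he0 : 0 ≤ e := integral_nonneg_of_ae (hSI.mono fun _ hv => hv.1)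
  have hp0 : 0 ≤ p := integral_nonneg_of_ae (hsI.mono fun _ hv => hv.1)
  have hp1 : p ≤ 1 := by
    calc p ≤ ∫ _, (1 : ℝ) ∂U :=
          integral_mono_ae hsint (integrable_const _) (hsI.mono fun _ hv => hv.2)
      _ = 1 := by simp
  set T : (Fin N → ℝ) → ℝ := fun v => maxEntry v - m with hTd
  set q : (Fin N → ℝ) → ℝ := fun u => secmax u - p with hqd
  have hT : IsTilt prior T := by
    refine ⟨hsymm, by fun_prop, fun τ v => by simp [hTd, maxEntry_comp_perm], ?_, ?_⟩
    · filter_upwards [hMI] with v hv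
      exact abs_le.2 ⟨by linarith [hv.1], by linarith [hv.2]⟩
    · rw [hTd, integral_sub hMint (integrable_const _)]
      simp [hm, maxWelfare]
  have hq : IsTilt U q := by
    refine ⟨isExchangeable_pi _, by fun_prop, fun τ v => by simp [hqd, secmax_comp_perm hN], ?_, ?_⟩
    · filter_upwards [hsI] with v hv
      exact abs_le.2 ⟨by linarith [hv.1], by linarith [hv.2]⟩
    · rw [hqd, integral_sub hsint (integrable_const _)]
      simp [hp]
  have hTint : Integrable T prior := hMint.sub (integrable_const _)
  have hTM : Integrable (fun v => T v * maxEntry v) prior :=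
    hMint.bdd_mul (c := 1) hT.meas.aestronglyMeasurable (by simpa using hT.bound)
  set S := ∫ v, T v * maxEntry v ∂prior with hS
  have hS0 : 0 < S := by
    -- `S` is the variance of `maxEntry`: subtracting `m` from the second factor costs nothing, as
    -- `T` has mean zero.
    have h1 : S = ∫ v, T v * T v ∂prior := by
      have : ∀ v, T v * T v = T v * maxEntry v - T v * m := fun v => by simp only [hTd]; ring
      simp only [this]
      rw [integral_sub hTM (hTint.mul_const _), integral_mul_const, hT.mean]
      simp [hS]
    have h2 : 0 ≤ S := h1 ▸ integral_nonneg fun v => mul_self_nonneg _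
    refine lt_of_le_of_ne h2 fun h0 => hne ?_
    rw [h1, eq_comm, integral_eq_zero_iff_of_nonneg (fun v => mul_self_nonneg _)
      (hTint.bdd_mul (c := 1) hT.meas.aestronglyMeasurable (by simpa using hT.bound))] at h0
    filter_upwards [h0] with v hv
    exact sub_eq_zero.1 (mul_self_eq_zero.1 hv)
  obtain ⟨c, hmc, hc⟩ := exists_pos_measure_le_maxEntry hMint hne
  have hcv : c ≤ vbar := by
    by_contra! hlt
    refine hc (measure_mono_null (fun v hv => ?_) (ae_iff.1 hMI))
    exact fun h => absurd (hv.trans h.2) (not_le.2 hlt)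
  -- The bounds serve in turn: bids stay at most `c`; the tilt `κ = δ / S` stays below one; a
  -- loser's value, at most `e + κ`, stays below the lowest bid `R - δ`. The last also keeps bids
  -- nonnegative.
  obtain ⟨δ, hδ0, hδc, hδS, hδR⟩ : ∃ δ : ℝ, 0 < δ ∧ m + δ ≤ c ∧ δ / S < 1 ∧ e + δ / S + δ ≤ R := by
    refine ⟨min (c - m) (min (S / 2) ((R - e) / (1 / S + 1))), ?_, ?_, ?_, ?_⟩
    · have : 0 < R - e := sub_pos.2 hR
      have : 0 < c - m := sub_pos.2 hmc
      positivity
    · linarith [min_le_left (c - m) (min (S / 2) ((R - e) / (1 / S + 1)))]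
    · rw [div_lt_one hS0]
      have := (min_le_right (c - m) (min (S / 2) ((R - e) / (1 / S + 1)))).trans (min_le_left _ _)
      linarith
    · have := (min_le_right (c - m) (min (S / 2) ((R - e) / (1 / S + 1)))).trans (min_le_right _ _)
      rw [le_div_iff₀ (by positivity)] at this
      rw [div_eq_mul_one_div]
      linarith
  set κ := δ / S with hκ
  have hκ0 : 0 < κ := div_pos hδ0 hS0
  set Λ := couplingLaw prior U T q κ with hΛ
  have hΛp : IsProbabilityMeasure Λ := isProbabilityMeasure_couplingLaw hT hq hκ0.le hδS.le
  have hfst : Λ.map Prod.fst = prior := map_fst_couplingLaw hT hq hκ0.le hδS.le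
  have hsnd : Λ.map Prod.snd = U := map_snd_couplingLaw hT hq hκ0.le hδS.le
  -- The intercept centres the price: `secmax` of the bids is `R + δ * q u`, with mean `R`.
  set β₀ : ℝ → ℝ := fun s => R - δ * p + δ * s with hβ₀
  have hβ₀m : StrictMono β₀ := fun x y hxy => by simp only [hβ₀]; gcongr
  set β : ℝ → ℝ := fun s => β₀ (max 0 (min s 1)) with hβ
  have hβb : ∀ s, R - δ ≤ β s ∧ β s ≤ R + δ := fun s => by
    have h1 : 0 ≤ max 0 (min s 1) := le_max_left _ _
    have h2 : max 0 (min s 1) ≤ 1 := max_le zero_le_one (min_le_right _ _)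
    simp only [hβ, hβ₀]
    constructor <;> nlinarith
  have hβI : ∀ s, β s ∈ Set.Icc 0 vbar := fun s =>
    ⟨by linarith [(hβb s).1], by linarith [(hβb s).2]⟩
  have hβid : ∀ u : Fin N → ℝ, (∀ i, u i ∈ Set.Icc (0 : ℝ) 1) →
      (fun j => β (u j)) = fun j => β₀ (u j) := fun u hu => by
    ext j; simp [hβ, (hu j).1, (hu j).2]
  -- almost every signal profile has a single highest bidder
  have hgood : ∀ᵐ u ∂U, (∀ i, u i ∈ Set.Icc (0 : ℝ) 1) ∧ ∃ i, ∀ j, j ≠ i → u j < u i := by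
    filter_upwards [ae_pi_unitUniform_mem_Icc, ae_pi_injective unitUniform] with u hu hinj
    obtain ⟨i, hi⟩ := exists_eq_maxEntry u
    exact ⟨hu, i, fun j hj => lt_of_le_of_ne (hi ▸ le_maxEntry u j) (hinj j i hj)⟩
  have hsingle : ∀ {u : Fin N → ℝ} {i : Fin N}, (∀ j, j ≠ i → u j < u i) →
      ∀ f : Fin N → ℝ, ∑ j, alloc j u * f j = f i := fun {u i} hu f => by
    rw [Finset.sum_eq_single i, alloc_eq_one hu, one_mul]
    · intro j _ hj
      rw [alloc_eq_zero fun h => absurd (h i) (not_le.2 (hu j hj)), zero_mul]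
    · simp
  have hvb : ∀ i : Fin N, ∀ᵐ v ∂prior, |v i| ≤ vbar := fun i =>
    hprior.mono fun v hv => habs (hv i)
  have hvint : ∀ i : Fin N, Integrable (fun v : Fin N → ℝ => v i) prior := fun i =>
    .of_bound (measurable_pi_apply i).aestronglyMeasurable vbar (hvb i)
  set w : Fin N → (Fin N → ℝ) → ℝ := fun i u => ∫ v, couplingDensity T q κ (v, u) * v i ∂prior
    with hw
  -- The highest signal marks the highest value, so the winner's value may be replaced by
  -- `maxEntry`; the tilt then adds `κ * S * q u`, which is `δ * q u` by the choice of `κ`.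
  have hwin : ∀ {u : Fin N → ℝ} {i : Fin N}, (∀ j, j ≠ i → u j < u i) →
      w i u = m + δ * q u := fun {u i} hu => by
    simp only [hw]
    rw [hT.integral_couplingDensity_mul (hvint i), hsingle hu]
    have h1 : ∀ v : Fin N → ℝ, alloc i v * (v i * (1 + κ * T v * q u))
        = alloc i v * (maxEntry v * (1 + κ * T v * q u)) := fun v => by
      rw [← mul_assoc, alloc_mul_self, mul_assoc]
    simp only [h1]
    rw [hT.integral_alloc_mul measurable_maxEntry hMint maxEntry_comp_perm]
    have : κ * S = δ := div_mul_cancel₀ _ hS0.ne'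
    calc m + κ * q u * S = m + κ * S * q u := by ring
      _ = _ := by rw [this]
  -- When `j` has the highest value, the value of `i` is at most `secmax`, whose untilted mean is
  -- `e`; the tilt shifts it by at most `κ`.
  have hlose : ∀ {u : Fin N → ℝ} {i j : Fin N}, i ≠ j → |q u| ≤ 1 →
      (∀ k, k ≠ j → u k < u j) → w i u ≤ e + κ := fun {u i j} hij hqu hu => by
    simp only [hw]
    rw [hT.integral_couplingDensity_mul (hvint i), hsingle hu]
    have h1 : ∫ v, alloc j v * (v i * (1 + κ * T v * q u)) ∂prior
        ≤ ∫ v, alloc j v * (secmax v * (1 + κ * T v * q u)) ∂prior := by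
      refine integral_mono_ae (hT.integrable_alloc_mul (hvint i) _ j)
        (hT.integrable_alloc_mul hSint _ j) ?_
      filter_upwards [hT.bound] with v hv
      have h2 : |κ * T v * q u| ≤ 1 := by
        rw [abs_mul, abs_mul, abs_of_nonneg hκ0.le]
        exact mul_le_one₀ (mul_le_one₀ hδS.le (abs_nonneg _) hv) (abs_nonneg _) hqu
      rw [← mul_assoc, ← mul_assoc]
      exact mul_le_mul_of_nonneg_right (alloc_mul_le_alloc_mul_secmax hij v)
        (by linarith [(abs_le.1 h2).1])
    refine (mul_le_mul_of_nonneg_left h1 (Nat.cast_nonneg N)).trans ?_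
    rw [hT.integral_alloc_mul measurable_secmax hSint (secmax_comp_perm hN)]
    have h3 : |∫ v, T v * secmax v ∂prior| ≤ 1 := by
      have := norm_integral_le_of_norm_le_const (μ := prior) (C := 1)
        (f := fun v => T v * secmax v) (by
          filter_upwards [hT.bound, hSI] with v hv hs
          rw [norm_mul]
          exact mul_le_one₀ hv (norm_nonneg _) ((habs hs).trans hv1))
      simpa using this
    have h4 : q u * ∫ v, T v * secmax v ∂prior ≤ 1 := by
      refine (le_abs_self _).trans ?_
      rw [abs_mul]
      exact mul_le_one₀ hqu (abs_nonneg _) h3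
    have h5 : κ * (q u * ∫ v, T v * secmax v ∂prior) ≤ κ := mul_le_of_le_one_right hκ0.le h4
    rw [mul_assoc]
    linarith
  have hrev : ∫ ω, secmax (fun j => β (ω.2 j)) ∂Λ = R := by
    have hβm : Measurable fun u : Fin N → ℝ => fun j => β (u j) := by
      simp only [hβ, hβ₀]; fun_prop
    have h1 := integral_map (μ := Λ) measurable_snd.aemeasurable
      (f := fun u : Fin N → ℝ => secmax fun j => β (u j))
      (measurable_secmax.comp hβm).aestronglyMeasurable
    rw [← h1, hsnd]
    calc _ = ∫ u, (R - δ * p + δ * secmax u) ∂U := by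
          refine integral_congr_ae ?_
          filter_upwards [hgood] with u hu
          rw [hβid u hu.1, secmax_comp_of_monotone hN hβ₀m.monotone]
      _ = R := by
          rw [integral_add (integrable_const _) (hsint.const_mul _), integral_const_mul]
          simp [hp]
  rw [← hrev]
  refine exists_equilibrium_of_real_signals hN hprior Λ hfst (fun _ => unitUniform) hsnd β
    (by simp only [hβ, hβ₀]; fun_prop) hβI w ?_ ?_ ?_ ?_ ?_
  · exact fun i => integrable_condValue hT hq hκ0.le hδS.le (measurable_pi_apply i) (hvb i)
  · exact fun i X hX hX1 =>
      integral_couplingLaw_mul hT hq hκ0.le hδS.le (measurable_pi_apply i) (hvb i) hX hX1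
  · intro i
    have hΛgood : ∀ᵐ ω ∂Λ, ((∀ i, ω.2 i ∈ Set.Icc (0 : ℝ) 1) ∧
        ∃ i, ∀ j, j ≠ i → ω.2 j < ω.2 i) ∧ |q ω.2| ≤ 1 :=
      ae_of_ae_map measurable_snd.aemeasurable (by rw [hsnd]; exact hgood.and hq.bound)
    filter_upwards [hΛgood] with ω ⟨⟨hω, j, hj⟩, hqω⟩
    rw [hβid _ hω]
    refine le_alloc_mul_of_winner_or_loser hN i _ _ ?_
    by_cases hij : i = j
    · subst hij
      refine Or.inl ⟨fun k hk => hβ₀m (hj k hk), ?_⟩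
      -- Price `R + δ * q u` against value `m + δ * q u`: the fluctuations cancel and `R ≤ m`
      -- remains.
      rw [secmax_comp_of_monotone hN hβ₀m.monotone, hwin hj]
      simp only [hβ₀, hqd]
      linarith
    · refine Or.inr ⟨j, hβ₀m (hj i hij), (hlose hij hqω hj).trans ?_⟩
      have h1 := (hβb (ω.2 j)).1
      have h2 : β (ω.2 j) = β₀ (ω.2 j) := congrFun (hβid _ hω) j
      linarith
  · have hρm := measurable_couplingDensity hT.meas hq.meas κ
    -- Efficiency is built into the coupling: the density vanishes where the bidder with the highest
    -- signal does not have a highest value.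
    rw [hΛ, couplingLaw, ae_withDensity_iff hρm.ennreal_ofReal]
    filter_upwards [Measure.quasiMeasurePreserving_snd.ae hgood] with ω ⟨hω, i, hi⟩ hne0
    rw [hβid _ hω]
    simp only [alloc_comp_of_strictMono hβ₀m, hsingle hi]
    refine eq_maxEntry_of_mem (mem_highestBidders.2 ?_)
    by_contra hcon
    refine hne0 ?_
    have : couplingDensity T q κ ω
        = ∑ j, alloc j ω.2 * (N * (alloc j ω.1 * (1 + κ * T ω.1 * q ω.2))) :=
      Finset.sum_congr rfl fun j _ => by ring
    rw [this, hsingle hi, alloc_eq_zero hcon]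
    simp
  · intro i
    filter_upwards [ae_condDistrib_couplingLaw_pos hT hq hκ0.le hδS hc i] with s hs
    -- Every bid is at most `R + δ ≤ m + δ ≤ c`.
    refine hs.trans_le (measure_mono (Set.Ici_subset_Ici.2 ?_))
    linarith [(hβb s).2]

end Construction

end

end SecondPriceAuction

theorem mainTheorem5 {N : ℕ} (hN : 2 ≤ N)
    (V : Set ℝ) (vbar : ℝ) (hVc : V.Countable) (hV : V ⊆ Set.Icc 0 1) (hvbar : IsGreatest V vbar)
    (prior : Measure (Fin N → ℝ)) [IsProbabilityMeasure prior]
    (hprior : ∀ᵐ v ∂prior, ∀ i, v i ∈ V)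
    (hsymm : SecondPriceAuction.IsExchangeable prior)
    (hprod : SecondPriceAuction.IsProductPrior prior)
    (B R : ℝ) (hB : 0 ≤ B) (hR : 0 ≤ R)
    (hBR : B + R = SecondPriceAuction.maxWelfare prior)
    (hBF : B ≤ SecondPriceAuction.fullInfoSurplus prior) :
    ∃ I : SecondPriceAuction.InfoStructure prior, I.IsPrivatePrivate ∧
      ∃ σ : I.Profile vbar, I.IsEquilibrium σ ∧ I.NoOverbidding σ ∧
        I.revenue σ = R ∧ I.totalBidderSurplus σ = B := by
  open SecondPriceAuction in
  have hv := hV hvbar.1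
  have hprior' : ∀ᵐ v ∂prior, ∀ i, v i ∈ Set.Icc 0 vbar := by
    filter_upwards [hprior] with v h i using ⟨(hV (h i)).1, hvbar.2 (h i)⟩
  have : Nonempty (Fin N) := ⟨⟨0, by omega⟩⟩
  have hMint : Integrable (maxEntry (N := N)) prior :=
    .of_bound measurable_maxEntry.aestronglyMeasurable vbar (hprior'.mono fun v h => by
      have := maxEntry_mem_Icc h
      rw [Real.norm_eq_abs, abs_of_nonneg this.1]; exact this.2)
  have hSint : Integrable (secmax (N := N)) prior :=
    .of_bound measurable_secmax.aestronglyMeasurable vbar (hprior'.mono fun v h => by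
      have := secmax_mem_Icc hN h
      rw [Real.norm_eq_abs, abs_of_nonneg this.1]; exact this.2)
  have hF : fullInfoSurplus prior = maxWelfare prior - ∫ v, secmax v ∂prior :=
    integral_sub hMint hSint
  suffices ∃ I : InfoStructure prior, I.IsPrivatePrivate ∧
      ∃ σ : I.Profile vbar, I.IsEquilibrium σ ∧ I.NoOverbidding σ ∧ I.revenue σ = R ∧
        I.totalBidderSurplus σ + I.revenue σ = maxWelfare prior by
    obtain ⟨I, h1, σ, h2, h3, h4, h5⟩ := this
    exact ⟨I, h1, σ, h2, h3, h4, by linarith⟩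
  -- The bound of `B` by the full-information surplus says exactly that `R` is at least the
  -- full-information revenue.
  rcases eq_or_lt_of_le (show ∫ v, secmax v ∂prior ≤ R by linarith) with heq | hlt
  · rw [← heq]
    exact exists_equilibrium_fullInformation hN hv.1 hprior' hprod
  · refine exists_equilibrium_couplingLaw hN hv.2 hprior' hsymm (fun h => ?_) hlt (by linarith)
    -- A constant highest value would make the full-information revenue equal to the maximal
    -- welfare, leaving no room for a larger `R`.
    have := fullInfoSurplus_eq_zero hN hsymm hprod h
    linarith
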